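/- Let $d\ge 1$ and let $\{|e_i\rangle\}_{i=0}^{d-1}$, $\{|f_i\rangle\}_{i=0}^{d-1}$ be orthonormal bases of $A\cong\mathbb C^d$ and $B\cong\mathbb C^d$. Let $\sigma$ be a density operator on $A'\otimes B'$, where $A'$ and $B'$ are finite-dimensional Hilbert spaces, let $U_0,\dots,U_{d-1}$ be unitaries on $A'\otimes B'$, and let $$\gamma=\frac1d\sum_{i,j=0}^{d-1}|e_if_i\rangle\langle e_jf_j|_{AB}\otimes U_i\sigma U_j^\dagger$$ be the corresponding private state, with conditional states $\sigma_i=U_i\sigma U_i^\dagger$; put $\widetilde\sigma=\sigma_0\otimes\sigma_1\otimes\cdots\otimes\sigma_{d-1}$. For a bipartite state $\rho$ let $E_r(\rho)=\inf_{\omega}D(\rho|\omega)$, the infimum being over separable states $\omega$, where $D(\rho|\omega)=\operatorname{Tr}\rho\log\rho-\operatorname{Tr}\rho\log\omega$ (and $+\infty$ if the support of $\rho$ is not contained in that of $\omega$), and let $E_r^\infty(\rho)=\lim_{n\to\infty}\frac1nE_r(\rho^{\otimes n})$. Separability refers to the cut Alice : Bob, that is, $AA':BB'$ for $\gamma$,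 $A':B'$ for each $\sigma_i$, and, for tensor products, all subsystems of Alice against all subsystems of Bob. All logarithms are natural. Then the limits defining $E_r^\infty(\gamma)$, $E_r^\infty(\widetilde\sigma)$ and $E_r^\infty(\sigma_i)$ exist, and $$E_r^\infty(\gamma)\le\log d+\frac1d\,E_r^\infty(\widetilde\sigma)\le\log d+\frac1d\sum_{i=0}^{d-1}E_r^\infty(\sigma_i).$$ -/

import Mathlib

open Filter Topology Matrix
open scoped ComplexOrder Kronecker

namespace QInfo

/-- Density operators: positive semidefinite matrices of trace one. -/
def IsDensity {n : Type*} [Fintype n] (ρ : Matrix n n ℂ) : Prop :=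
  ρ.PosSemidef ∧ ρ.trace = 1

/-- Separable states of a bipartite system with Alice's index type `a` and Bob's index type `b`:
convex combinations of products of density operators. -/
def IsSeparable {a b : Type*} [Fintype a] [Fintype b] (ω : Matrix (a × b) (a × b) ℂ) : Prop :=
  ω ∈ convexHull ℝ {τ : Matrix (a × b) (a × b) ℂ |
    ∃ (α : Matrix a a ℂ) (β : Matrix b b ℂ), IsDensity α ∧ IsDensity β ∧ τ = α ⊗ₖ β}

open Classical in
/-- The relative entropy `D(ρ|ω) = Tr ρ log ρ - Tr ρ log ω` of two density operators, which is `+∞`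
unless the support of `ρ` is contained in that of `ω` (equivalently `ker ω ⊆ ker ρ`). The operator
logarithm is taken on the support, since `Real.log 0 = 0`. -/
noncomputable def relEntropy {n : Type*} [Fintype n] [DecidableEq n] (ρ ω : Matrix n n ℂ) : EReal :=
  if ∀ v : n → ℂ, ω *ᵥ v = 0 → ρ *ᵥ v = 0 then
    (((ρ * cfc Real.log ρ).trace.re - (ρ * cfc Real.log ω).trace.re : ℝ) : EReal)
  else ⊤

/-- The relative entropy of entanglement `E_r(ρ) = inf_{ω separable} D(ρ|ω)`. -/
noncomputable def relEntEnt {a b : Type*} [Fintype a] [Fintype b] [DecidableEq a] [DecidableEq b]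
    (ρ : Matrix (a × b) (a × b) ℂ) : EReal :=
  ⨅ (ω : Matrix (a × b) (a × b) ℂ) (_ : IsSeparable ω), relEntropy ρ ω

/-- The tensor product of a finite family of bipartite states, seen as a bipartite state: all of
Alice's subsystems are collected on one side, all of Bob's on the other. -/
def tensorFamily {ι a b : Type*} [Fintype ι] (ρ : ι → Matrix (a × b) (a × b) ℂ) :
    Matrix ((ι → a) × (ι → b)) ((ι → a) × (ι → b)) ℂ :=
  Matrix.of fun p q => ∏ i, ρ i (p.1 i, p.2 i) (q.1 i, q.2 i)

/-- The bipartite tensor power `ρ^{⊗ n}`. -/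
def tensorPower {a b : Type*} (ρ : Matrix (a × b) (a × b) ℂ) (n : ℕ) :
    Matrix ((Fin n → a) × (Fin n → b)) ((Fin n → a) × (Fin n → b)) ℂ :=
  tensorFamily fun _ : Fin n => ρ

/-- The rate `(1/n) E_r(ρ^{⊗ n})`. -/
noncomputable def relEntEntRate {a b : Type*} [Fintype a] [Fintype b] [DecidableEq a]
    [DecidableEq b] (ρ : Matrix (a × b) (a × b) ℂ) (n : ℕ) : EReal :=
  ((1 / (n : ℝ) : ℝ) : EReal) * relEntEnt (tensorPower ρ n)

/-- The regularized relative entropy of entanglement `E_r^∞(ρ) = lim_n (1/n) E_r(ρ^{⊗ n})`. -/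
noncomputable def regRelEntEnt {a b : Type*} [Fintype a] [Fintype b] [DecidableEq a]
    [DecidableEq b] (ρ : Matrix (a × b) (a × b) ℂ) : EReal :=
  limUnder atTop (relEntEntRate ρ)

/-- The private state
`γ = (1/d) ∑_{i,j} |e_i f_i⟩⟨e_j f_j|_{AB} ⊗ (U_i σ U_j†)_{A'B'}`,
as a bipartite state for the cut `AA' : BB'`. The key part is `A`, `B` (both of dimension `d`), and
the shield is `A'` (index type `a`), `B'` (index type `b`). -/
noncomputable def privateState {d : ℕ} {a b : Type*} [Fintype a] [Fintype b] [DecidableEq a]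
    [DecidableEq b] (e f : OrthonormalBasis (Fin d) ℂ (EuclideanSpace ℂ (Fin d)))
    (U : Fin d → Matrix.unitaryGroup (a × b) ℂ) (σ : Matrix (a × b) (a × b) ℂ) :
    Matrix ((Fin d × a) × (Fin d × b)) ((Fin d × a) × (Fin d × b)) ℂ :=
  Matrix.of fun p q => (1 / (d : ℂ)) * ∑ i, ∑ j,
    (e i p.1.1 * f i p.2.1) * star (e j q.1.1 * f j q.2.1) *
      ((U i : Matrix (a × b) (a × b) ℂ) * σ * (U j : Matrix (a × b) (a × b) ℂ)ᴴ)
        (p.1.2, p.2.2) (q.1.2, q.2.2)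

/-- The conditional states `σ_i = U_i σ U_i†` on the shield. -/
def conditionalState {d : ℕ} {a b : Type*} [Fintype a] [Fintype b] [DecidableEq a]
    [DecidableEq b] (U : Fin d → Matrix.unitaryGroup (a × b) ℂ) (σ : Matrix (a × b) (a × b) ℂ)
    (i : Fin d) : Matrix (a × b) (a × b) ℂ :=
  (U i : Matrix (a × b) (a × b) ℂ) * σ * (U i : Matrix (a × b) (a × b) ℂ)ᴴ

end QInfo

set_option linter.unusedSectionVars false

/-! Let Z = d^{-1/2} ∑_i |e_i f_i⟩ ⊗ U_i. This is an isometry with γ = ZσZ†, so γ^{⊗n} and every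
word state σ_w = ⊗_k σ_{w_k}, w ∈ [d]^n, have the same entropy, n times that of σ. Compressing
γ^{⊗n} to the key word w gives d^{-n} σ_w. If ω_w is separable and nearly optimal for σ_w, the
uniform mixture of the states |e_w f_w⟩⟨e_w f_w| ⊗ ω_w is separable, and its logarithm is block
diagonal, so it sees only these compressions of γ^{⊗n}. Hence E_r(γ^{⊗n}) ≤ n log d + d^{-n} ∑_w
E_r(σ_w) (`entReal_le_log_card_add`, `entReal_tensorPower_privateState_le`).

In a typical word each letter occurs about n/d times. With m the least letter count, σ_w consists of
m copies of σ̃ and n - dm further factors of bounded cost, and E_r is subadditive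
(`entReal_tensorFamily_word_le`). Letter counts have variance O(n), so n - dm is o(n) on average;
dividing by n gives the first inequality (`rate_privateState_le`). The second is subadditivity once
more, and the limits exist by Fekete's lemma. -/

namespace QInfo

/-! ### Spectral forms and the logarithm on the support -/

section SpectralForm

variable {n k : Type*} [Fintype n] [Fintype k] [DecidableEq n] [DecidableEq k]

/-- `ω = V diag(w) V†` with orthonormal columns `V` and positive weights `w`. -/
structure IsSpectralForm (ω : Matrix n n ℂ) (V : Matrix n k ℂ) (w : k → ℝ) : Prop where
  isometry : Vᴴ * V = 1
  pos : ∀ x, 0 < w x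
  eq : ω = V * diagonal (fun x => (w x : ℂ)) * Vᴴ

/-- The matrix acts as diag(w) on the range of V and as 0 on its orthogonal complement, whose
projection is 1 - VV†. -/
theorem aeval_conj_diagonal (V : Matrix n k ℂ) (hV : Vᴴ * V = 1) (w : k → ℝ)
    (q : Polynomial ℝ) :
    Polynomial.aeval (V * diagonal (fun x => (w x : ℂ)) * Vᴴ) q =
      V * diagonal (fun x => ((q.eval (w x) : ℝ) : ℂ)) * Vᴴ +
        ((q.eval 0 : ℝ) : ℂ) • (1 - V * Vᴴ) := by
  induction q using Polynomial.induction_on' with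
  | add p q hp hq =>
    rw [map_add, hp, hq]
    simp only [Polynomial.eval_add, Complex.ofReal_add, ← diagonal_add, Matrix.mul_add,
      Matrix.add_mul, add_smul]
    abel
  | monomial m a =>
    have hpow : ∀ m : ℕ, (V * diagonal (fun x => (w x : ℂ)) * Vᴴ) ^ (m + 1) =
        V * diagonal (fun x => ((w x ^ (m + 1) : ℝ) : ℂ)) * Vᴴ := by
      intro m
      induction m with
      | zero => simp
      | succ m ih =>
        rw [pow_succ, ih]
        calc _ = V * diagonal (fun x => ((w x ^ (m + 1) : ℝ) : ℂ)) * (Vᴴ * V) *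
              diagonal (fun x => (w x : ℂ)) * Vᴴ := by simp only [Matrix.mul_assoc]
          _ = _ := by
            rw [hV, Matrix.mul_one, Matrix.mul_assoc V, diagonal_mul_diagonal]
            congr 3
            funext x
            push_cast
            ring
    rw [Polynomial.aeval_monomial]
    cases m with
    | zero =>
      have h1 : diagonal (fun _ : k => (a : ℂ)) = (a : ℂ) • (1 : Matrix k k ℂ) := by
        rw [smul_one_eq_diagonal]
      simp only [pow_zero, mul_one, Polynomial.eval_monomial, h1]
      rw [Algebra.algebraMap_eq_smul_one, Matrix.mul_smul, Matrix.mul_one, Matrix.smul_mul,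
        ← smul_add, add_sub_cancel, Complex.coe_smul]
    | succ m =>
      rw [hpow, Algebra.algebraMap_eq_smul_one, smul_mul_assoc, one_mul, ← Complex.coe_smul,
        ← Matrix.smul_mul, ← Matrix.mul_smul, ← diagonal_smul]
      simp only [Polynomial.eval_monomial, ne_eq, Nat.add_eq_zero_iff, one_ne_zero, and_false,
        not_false_eq_true, zero_pow, mul_zero, Complex.ofReal_zero, zero_smul, add_zero]
      congr 3
      funext x
      simp

/-- The spectrum lies in the finite set of weights together with 0, where f agrees with a Lagrange
polynomial; f 0 = 0 removes the term on the complement. It applies to `Real.log` because `Real.log 0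
= 0`. -/
theorem cfc_conj_diagonal (V : Matrix n k ℂ) (hV : Vᴴ * V = 1) (w : k → ℝ) (f : ℝ → ℝ)
    (hf : f 0 = 0) :
    cfc f (V * diagonal (fun x => (w x : ℂ)) * Vᴴ) =
      V * diagonal (fun x => (f (w x) : ℂ)) * Vᴴ := by
  classical
  rcases isEmpty_or_nonempty n with hn | hn
  · exact Subsingleton.elim _ _
  set ω := V * diagonal (fun x => (w x : ℂ)) * Vᴴ with hω
  have hsa : IsSelfAdjoint ω := by
    rw [IsSelfAdjoint, star_eq_conjTranspose, hω]
    simp only [conjTranspose_mul, conjTranspose_conjTranspose, diagonal_conjTranspose,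
      Matrix.mul_assoc]
    congr 3
    funext x
    simp
  let s : Finset ℝ := insert 0 (Finset.univ.image w)
  have hspec : spectrum ℝ ω ⊆ s := by
    intro r hr
    let p : Polynomial ℝ := ∏ x ∈ s, (Polynomial.X - Polynomial.C x)
    have hp : ∀ x ∈ s, p.eval x = 0 := fun x hx => by
      rw [Polynomial.eval_prod]
      exact Finset.prod_eq_zero hx (by simp)
    have h0 : Polynomial.aeval ω p = 0 := by
      rw [hω, aeval_conj_diagonal V hV w p, hp 0 (by simp [s])]
      have : ∀ x, p.eval (w x) = 0 := fun x => hp _ (by simp [s])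
      simp [this]
    have h1 := spectrum.subset_polynomial_aeval ω p ⟨r, hr, rfl⟩
    rw [h0, spectrum.zero_eq, Set.mem_singleton_iff] at h1
    simp only [p, Polynomial.eval_prod, Finset.prod_eq_zero_iff] at h1
    obtain ⟨x, hx, hx'⟩ := h1
    have : r = x := by simpa [sub_eq_zero] using hx'
    exact this ▸ hx
  let q := Lagrange.interpolate s id f
  have hq : ∀ x ∈ s, q.eval x = f x := fun x hx =>
    Lagrange.eval_interpolate_at_node f (v := id) (Set.injOn_id _) hx
  have : cfc f ω = cfc q.eval ω := cfc_congr fun x hx => (hq x (hspec hx)).symm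
  rw [this, cfc_polynomial q ω hsa, hω, aeval_conj_diagonal V hV w q, hq 0 (by simp [s]), hf]
  have : ∀ x, q.eval (w x) = f (w x) := fun x => hq _ (by simp [s])
  simp [this]

theorem mul_diagonal_conjTranspose_apply (M : Matrix n k ℂ) (c : k → ℂ) (i j : n) :
    (M * diagonal c * Mᴴ) i j = ∑ x, M i x * c x * star (M j x) := by
  rw [Matrix.mul_apply]
  simp only [mul_diagonal, conjTranspose_apply]

/-- Only the eigenvectors with nonzero eigenvalue are kept, so that the range of V is exactly the
support of ω. -/
theorem exists_isSpectralForm {ω : Matrix n n ℂ} (h : ω.PosSemidef) :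
    ∃ (V : Matrix n {i : n // h.1.eigenvalues i ≠ 0} ℂ) (w : _ → ℝ), IsSpectralForm ω V w := by
  have hU : (h.1.eigenvectorUnitary : Matrix n n ℂ)ᴴ *
      (h.1.eigenvectorUnitary : Matrix n n ℂ) = 1 :=
    Unitary.coe_star_mul_self _
  refine ⟨(h.1.eigenvectorUnitary : Matrix n n ℂ).submatrix id Subtype.val,
    fun i => h.1.eigenvalues i.1, ?_, ?_, ?_⟩
  · ext i j
    have := congrFun (congrFun hU i.1) j.1
    rw [Matrix.mul_apply] at this
    simp only [Matrix.mul_apply, conjTranspose_apply, submatrix_apply, id] at this ⊢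
    rw [this, Matrix.one_apply, Matrix.one_apply]
    simp [Subtype.ext_iff]
  · exact fun i => lt_of_le_of_ne (h.eigenvalues_nonneg _) (Ne.symm i.2)
  · conv_lhs => rw [h.1.spectral_theorem, Unitary.conjStarAlgAut_apply]
    ext i j
    rw [star_eq_conjTranspose, mul_diagonal_conjTranspose_apply,
      mul_diagonal_conjTranspose_apply]
    symm
    have := Finset.sum_subtype (Finset.univ.filter fun x => h.1.eigenvalues x ≠ 0)
      (p := fun x => h.1.eigenvalues x ≠ 0) (F := inferInstance) (by simp)
      (fun x => (h.1.eigenvectorUnitary : Matrix n n ℂ) i x * (h.1.eigenvalues x : ℂ) *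
        star ((h.1.eigenvectorUnitary : Matrix n n ℂ) j x))
    simp only [submatrix_apply, id]
    refine this.symm.trans (Finset.sum_filter_of_ne fun x _ hx h0 => hx ?_)
    simp [h0]

/-- The trace `Tr ρ log ω`. -/
noncomputable def traceLog (ρ ω : Matrix n n ℂ) : ℂ := (ρ * cfc Real.log ω).trace

namespace IsSpectralForm

variable {ω : Matrix n n ℂ} {V : Matrix n k ℂ} {w : k → ℝ}

theorem traceLog_eq (h : IsSpectralForm ω V w) (ρ : Matrix n n ℂ) :
    traceLog ρ ω = ∑ x, (Real.log (w x) : ℂ) * (Vᴴ * ρ * V) x x := by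
  rw [traceLog, h.eq, cfc_conj_diagonal V h.isometry w Real.log Real.log_zero]
  calc _ = (Vᴴ * ρ * V * diagonal (fun x => (Real.log (w x) : ℂ))).trace := by
        rw [Matrix.trace_mul_comm, ← Matrix.trace_mul_comm (diagonal _), Matrix.mul_assoc V,
          Matrix.mul_assoc V, Matrix.trace_mul_comm V]
        simp only [Matrix.mul_assoc]
    _ = _ := by simp [Matrix.trace, mul_comm]

theorem mul_conj (h : IsSpectralForm ω V w) : ω * (V * Vᴴ) = ω := by
  rw [h.eq]
  calc _ = V * diagonal (fun x => (w x : ℂ)) * (Vᴴ * V) * Vᴴ := by simp only [Matrix.mul_assoc]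
    _ = _ := by rw [h.isometry, Matrix.mul_one]

theorem mulVec_eq_zero_iff (h : IsSpectralForm ω V w) (v : n → ℂ) :
    ω *ᵥ v = 0 ↔ Vᴴ *ᵥ v = 0 := by
  constructor
  · intro h0
    have h1 : Vᴴ *ᵥ (ω *ᵥ v) = diagonal (fun x => (w x : ℂ)) *ᵥ (Vᴴ *ᵥ v) := by
      rw [Matrix.mulVec_mulVec, Matrix.mulVec_mulVec, h.eq]
      congr 1
      calc _ = (Vᴴ * V) * diagonal (fun x => (w x : ℂ)) * Vᴴ := by simp only [Matrix.mul_assoc]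
        _ = _ := by rw [h.isometry, Matrix.one_mul]
    rw [h0, Matrix.mulVec_zero] at h1
    funext x
    have := congrFun h1 x
    rw [mulVec_diagonal] at this
    simpa [(h.pos x).ne'] using this.symm
  · intro h0
    rw [h.eq, ← Matrix.mulVec_mulVec, h0, Matrix.mulVec_zero]

/-- VV† is the projection onto the support of ω. The matrix identity, unlike the condition on
kernels, passes at once to tensor products. -/
theorem support_iff (h : IsSpectralForm ω V w) (ρ : Matrix n n ℂ) :
    (∀ v : n → ℂ, ω *ᵥ v = 0 → ρ *ᵥ v = 0) ↔ ρ * (V * Vᴴ) = ρ := by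
  constructor
  · intro hs
    have hz : ω * (1 - V * Vᴴ) = 0 := by rw [Matrix.mul_sub, h.mul_conj, Matrix.mul_one, sub_self]
    have : ρ * (1 - V * Vᴴ) = 0 := by
      ext i j
      have h1 := hs ((1 - V * Vᴴ).col j) (by
        funext i
        exact congrFun (congrFun hz i) j)
      exact congrFun h1 i
    rw [Matrix.mul_sub, Matrix.mul_one, sub_eq_zero] at this
    exact this.symm
  · intro hs v hv
    rw [h.mulVec_eq_zero_iff] at hv
    rw [← hs, ← Matrix.mul_assoc, ← Matrix.mulVec_mulVec, hv, Matrix.mulVec_zero]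

theorem trace_eq (h : IsSpectralForm ω V w) : ω.trace = ∑ x, (w x : ℂ) := by
  rw [h.eq, Matrix.trace_mul_comm, ← Matrix.mul_assoc, h.isometry, Matrix.one_mul]
  simp [Matrix.trace]

theorem trace_conj {ρ : Matrix n n ℂ} (hs : ρ * (V * Vᴴ) = ρ) : (Vᴴ * ρ * V).trace = ρ.trace := by
  rw [Matrix.mul_assoc, Matrix.trace_mul_comm, Matrix.mul_assoc, hs]

theorem traceLog_self (h : IsSpectralForm ω V w) :
    traceLog ω ω = ∑ x, (Real.log (w x) : ℂ) * (w x : ℂ) := by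
  rw [h.traceLog_eq]
  have : Vᴴ * ω * V = diagonal (fun x => (w x : ℂ)) := by
    rw [h.eq]
    calc _ = (Vᴴ * V) * diagonal (fun x => (w x : ℂ)) * (Vᴴ * V) := by simp only [Matrix.mul_assoc]
      _ = _ := by rw [h.isometry, Matrix.one_mul, Matrix.mul_one]
  simp [this]

/-- Conjugation by an isometry preserves spectral forms. -/
theorem conj {m : Type*} [Fintype m] [DecidableEq m] (h : IsSpectralForm ω V w)
    {Z : Matrix m n ℂ} (hZ : Zᴴ * Z = 1) : IsSpectralForm (Z * ω * Zᴴ) (Z * V) w where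
  isometry := by
    rw [conjTranspose_mul, Matrix.mul_assoc, ← Matrix.mul_assoc Zᴴ, hZ, Matrix.one_mul, h.isometry]
  pos := h.pos
  eq := by rw [h.eq, conjTranspose_mul]; simp only [Matrix.mul_assoc]

end IsSpectralForm

/-- An isometry keeps the positive eigenvalues and adds only zeros. This gives γ and all the σ_i the
entropy of σ. -/
theorem traceLog_conj {m : Type*} [Fintype m] [DecidableEq m] {ρ : Matrix n n ℂ}
    (hρ : ρ.PosSemidef) {Z : Matrix m n ℂ} (hZ : Zᴴ * Z = 1) :
    traceLog (Z * ρ * Zᴴ) (Z * ρ * Zᴴ) = traceLog ρ ρ := by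
  obtain ⟨V, w, h⟩ := exists_isSpectralForm hρ
  rw [h.traceLog_self, (h.conj hZ).traceLog_self]

end SpectralForm

/-! ### Tensor products of families of matrices -/

section PiKron

variable {ι : Type*} [Fintype ι] [DecidableEq ι]

/-- The tensor product of a finite family of rectangular matrices. -/
def piKron {n m : ι → Type*} (M : ∀ i, Matrix (n i) (m i) ℂ) :
    Matrix (∀ i, n i) (∀ i, m i) ℂ :=
  Matrix.of fun p q => ∏ i, M i (p i) (q i)

variable {n m l : ι → Type*}

theorem piKron_mul [∀ i, Fintype (m i)] (M : ∀ i, Matrix (n i) (m i) ℂ)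
    (N : ∀ i, Matrix (m i) (l i) ℂ) : piKron M * piKron N = piKron fun i => M i * N i := by
  ext p q
  simp only [piKron, Matrix.mul_apply, of_apply, Fintype.prod_sum, Finset.prod_mul_distrib]

theorem piKron_conjTranspose (M : ∀ i, Matrix (n i) (m i) ℂ) :
    (piKron M)ᴴ = piKron fun i => (M i)ᴴ := by
  ext p q
  simp [piKron, conjTranspose_apply]

theorem piKron_diagonal [∀ i, DecidableEq (n i)] (c : ∀ i, n i → ℂ) :
    piKron (fun i => diagonal (c i)) = diagonal fun p => ∏ i, c i (p i) := by
  ext p q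
  simp only [piKron, of_apply, diagonal_apply]
  split_ifs with h
  · subst h; simp
  · obtain ⟨i, hi⟩ := Function.ne_iff.1 h
    exact Finset.prod_eq_zero (Finset.mem_univ i) (by simp [hi])

theorem piKron_one [∀ i, DecidableEq (n i)] :
    piKron (fun i => (1 : Matrix (n i) (n i) ℂ)) = 1 := by
  have := piKron_diagonal (n := n) (fun _ _ => 1)
  simpa using this

theorem trace_piKron [∀ i, Fintype (n i)] (M : ∀ i, Matrix (n i) (n i) ℂ) :
    (piKron M).trace = ∏ i, (M i).trace := by
  simp only [Matrix.trace, piKron, diag_apply, of_apply, Fintype.prod_sum]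

end PiKron

/-! ### Additivity of Tr ρ log ω under tensor products -/

section SpectralForm

variable {n k : Type*} [Fintype n] [Fintype k] [DecidableEq n] [DecidableEq k]

theorem IsSpectralForm.posSemidef {ω : Matrix n n ℂ} {V : Matrix n k ℂ} {w : k → ℝ}
    (h : IsSpectralForm ω V w) : ω.PosSemidef := by
  rw [h.eq]
  refine PosSemidef.mul_mul_conjTranspose_same (PosSemidef.diagonal fun x => ?_) V
  exact Complex.zero_le_real.2 (h.pos x).le

theorem IsSpectralForm.submatrix {ω : Matrix n n ℂ} {V : Matrix n k ℂ} {w : k → ℝ}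
    (h : IsSpectralForm ω V w) {n' : Type*} [Fintype n'] [DecidableEq n'] (e : n' ≃ n) :
    IsSpectralForm (ω.submatrix e e) (V.submatrix e id) w where
  isometry := by
    rw [conjTranspose_submatrix, submatrix_mul_equiv, h.isometry, submatrix_id_id]
  pos := h.pos
  eq := by
    conv_lhs => rw [h.eq]
    rw [conjTranspose_submatrix, ← submatrix_mul_equiv _ _ _ (Equiv.refl k),
      ← submatrix_mul_equiv _ _ _ (Equiv.refl k)]
    simp

variable {ι : Type*} [Fintype ι] [DecidableEq ι] {n k : ι → Type*} [∀ i, Fintype (n i)]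
  [∀ i, Fintype (k i)] [∀ i, DecidableEq (n i)] [∀ i, DecidableEq (k i)]

theorem IsSpectralForm.piKron {ω : ∀ i, Matrix (n i) (n i) ℂ} {V : ∀ i, Matrix (n i) (k i) ℂ}
    {w : ∀ i, k i → ℝ} (h : ∀ i, IsSpectralForm (ω i) (V i) (w i)) :
    IsSpectralForm (piKron ω) (piKron V) (fun p => ∏ i, w i (p i)) where
  isometry := by
    rw [piKron_conjTranspose, piKron_mul]
    simp only [(h _).isometry, piKron_one]
  pos := fun p => Finset.prod_pos fun i _ => (h i).pos _
  eq := by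
    have : ω = fun i => V i * diagonal (fun x => (w i x : ℂ)) * (V i)ᴴ := funext fun i => (h i).eq
    rw [this, ← piKron_mul, ← piKron_mul, ← piKron_conjTranspose, piKron_diagonal]
    simp

/-- The logarithm of a product weight is a sum over the factors; in the i-th summand every other
factor contributes its trace on the support, which is 1 by `hs` and `ht`. -/
theorem traceLog_piKron {ρ ω : ∀ i, Matrix (n i) (n i) ℂ} {V : ∀ i, Matrix (n i) (k i) ℂ}
    {w : ∀ i, k i → ℝ} (h : ∀ i, IsSpectralForm (ω i) (V i) (w i))
    (hs : ∀ i, ρ i * (V i * (V i)ᴴ) = ρ i) (ht : ∀ i, (ρ i).trace = 1) :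
    traceLog (QInfo.piKron ρ) (QInfo.piKron ω) = ∑ i, traceLog (ρ i) (ω i) := by
  rw [(IsSpectralForm.piKron h).traceLog_eq]
  simp only [(h _).traceLog_eq]
  rw [piKron_conjTranspose, piKron_mul, piKron_mul]
  set P : ∀ i, Matrix (k i) (k i) ℂ := fun i => (V i)ᴴ * ρ i * V i with hP
  have hP1 : ∀ i, ∑ x, P i x x = 1 := fun i => by
    have := IsSpectralForm.trace_conj (hs i)
    rw [ht] at this
    exact this
  have hlog : ∀ p : ∀ i, k i, (Real.log (∏ i, w i (p i)) : ℂ) =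
      ∑ i, (Real.log (w i (p i)) : ℂ) := fun p => by
    rw [Real.log_prod (fun i _ => ((h i).pos _).ne')]
    push_cast
    rfl
  -- The logarithm is absorbed into the i-th factor, so that the sum over p factorizes.
  have hterm : ∀ (p : ∀ i, k i) (i : ι), (Real.log (w i (p i)) : ℂ) * ∏ j, P j (p j) (p j) =
      ∏ j, (if j = i then (Real.log (w j (p j)) : ℂ) else 1) * P j (p j) (p j) := fun p i => by
    rw [Finset.prod_mul_distrib, Finset.prod_ite_eq' Finset.univ i]
    simp
  calc _ = ∑ p : ∀ i, k i, ∑ i, (Real.log (w i (p i)) : ℂ) * ∏ j, P j (p j) (p j) := by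
        refine Finset.sum_congr rfl fun p _ => ?_
        rw [hlog, Finset.sum_mul]
        rfl
    _ = ∑ i, ∏ j, ∑ x, (if j = i then (Real.log (w j x) : ℂ) else 1) * P j x x := by
        rw [Finset.sum_comm]
        refine Finset.sum_congr rfl fun i _ => ?_
        rw [Fintype.prod_sum]
        exact Finset.sum_congr rfl fun p _ => hterm p i
    _ = _ := by
        refine Finset.sum_congr rfl fun i _ => ?_
        rw [Finset.prod_eq_single i]
        · simp [hP]
        · intro j _ hj
          simp [hj, hP1]
        · simp

end SpectralForm

section Submatrix

variable {n n' : Type*} [Fintype n] [Fintype n'] [DecidableEq n] [DecidableEq n']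

theorem traceLog_submatrix {ω : Matrix n n ℂ} (hω : ω.PosSemidef) (ρ : Matrix n n ℂ)
    (e : n' ≃ n) : traceLog (ρ.submatrix e e) (ω.submatrix e e) = traceLog ρ ω := by
  obtain ⟨V, w, h⟩ := exists_isSpectralForm hω
  rw [h.traceLog_eq, (h.submatrix e).traceLog_eq, conjTranspose_submatrix, submatrix_mul_equiv,
    submatrix_mul_equiv, submatrix_id_id]

end Submatrix

/-! ### Bipartite regrouping of tensor products -/

section BipTensor

variable {ι : Type*}

/-- Regrouping of the systems of a family of bipartite systems. -/
def pairPi (a b : ι → Type*) : ((∀ i, a i) × (∀ i, b i)) ≃ (∀ i, a i × b i) where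
  toFun p i := (p.1 i, p.2 i)
  invFun q := (fun i => (q i).1, fun i => (q i).2)
  left_inv _ := rfl
  right_inv _ := rfl

variable [Fintype ι] [DecidableEq ι] {a b c e g h : ι → Type*}

/-- The tensor product of a family of bipartite matrices, Alice's systems being collected on one
side and Bob's on the other. -/
def bipTensor (M : ∀ i, Matrix (a i × b i) (c i × e i) ℂ) :
    Matrix ((∀ i, a i) × (∀ i, b i)) ((∀ i, c i) × (∀ i, e i)) ℂ :=
  (piKron M).submatrix (pairPi a b) (pairPi c e)

theorem tensorFamily_eq_bipTensor {a b : Type*} (ρ : ι → Matrix (a × b) (a × b) ℂ) :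
    tensorFamily ρ = bipTensor (a := fun _ => a) (b := fun _ => b) (c := fun _ => a)
      (e := fun _ => b) ρ := rfl

theorem bipTensor_mul [∀ i, Fintype (c i)] [∀ i, Fintype (e i)]
    (M : ∀ i, Matrix (a i × b i) (c i × e i) ℂ) (N : ∀ i, Matrix (c i × e i) (g i × h i) ℂ) :
    bipTensor M * bipTensor N = bipTensor fun i => M i * N i := by
  rw [bipTensor, bipTensor, submatrix_mul_equiv, piKron_mul]
  rfl

theorem bipTensor_conjTranspose (M : ∀ i, Matrix (a i × b i) (c i × e i) ℂ) :
    (bipTensor M)ᴴ = bipTensor fun i => (M i)ᴴ := by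
  rw [bipTensor, conjTranspose_submatrix, piKron_conjTranspose]
  rfl

theorem bipTensor_kronecker (M : ∀ i, Matrix (a i) (c i) ℂ) (N : ∀ i, Matrix (b i) (e i) ℂ) :
    bipTensor (fun i => M i ⊗ₖ N i) = piKron M ⊗ₖ piKron N := by
  ext p q
  simp [bipTensor, piKron, pairPi, kroneckerMap_apply, Finset.prod_mul_distrib]

variable [∀ i, Fintype (a i)] [∀ i, Fintype (b i)]

theorem trace_bipTensor (M : ∀ i, Matrix (a i × b i) (a i × b i) ℂ) :
    (bipTensor M).trace = ∏ i, (M i).trace := by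
  rw [← trace_piKron]
  exact Fintype.sum_equiv (pairPi a b) _ _ fun _ => rfl

variable [∀ i, DecidableEq (a i)] [∀ i, DecidableEq (b i)]

theorem IsDensity.bipTensor {ρ : ∀ i, Matrix (a i × b i) (a i × b i) ℂ}
    (hρ : ∀ i, IsDensity (ρ i)) : IsDensity (bipTensor ρ) := by
  refine ⟨?_, by simp [trace_bipTensor, (hρ _).2]⟩
  choose V w h using fun i => exists_isSpectralForm (hρ i).1
  exact (IsSpectralForm.piKron h).posSemidef.submatrix _

theorem IsDensity.piKron {ρ : ∀ i, Matrix (a i) (a i) ℂ}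
    (hρ : ∀ i, IsDensity (ρ i)) : IsDensity (piKron ρ) := by
  refine ⟨?_, by simp [trace_piKron, (hρ _).2]⟩
  choose V w h using fun i => exists_isSpectralForm (hρ i).1
  exact (IsSpectralForm.piKron h).posSemidef

theorem traceLog_bipTensor {ρ ω : ∀ i, Matrix (a i × b i) (a i × b i) ℂ}
    (hω : ∀ i, (ω i).PosSemidef)
    (hs : ∀ i v, ω i *ᵥ v = 0 → ρ i *ᵥ v = 0) (ht : ∀ i, (ρ i).trace = 1) :
    traceLog (bipTensor ρ) (bipTensor ω) = ∑ i, traceLog (ρ i) (ω i) := by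
  choose V w h using fun i => exists_isSpectralForm (hω i)
  rw [bipTensor, bipTensor, traceLog_submatrix (IsSpectralForm.piKron h).posSemidef,
    traceLog_piKron h (fun i => ((h i).support_iff _).1 (hs i)) ht]

theorem support_bipTensor {ρ ω : ∀ i, Matrix (a i × b i) (a i × b i) ℂ}
    (hω : ∀ i, (ω i).PosSemidef) (hs : ∀ i v, ω i *ᵥ v = 0 → ρ i *ᵥ v = 0) :
    ∀ v, bipTensor ω *ᵥ v = 0 → bipTensor ρ *ᵥ v = 0 := by
  choose V w h using fun i => exists_isSpectralForm (hω i)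
  refine (((IsSpectralForm.piKron h).submatrix (pairPi a b)).support_iff (bipTensor ρ)).2 ?_
  have := fun i => ((h i).support_iff _).1 (hs i)
  rw [conjTranspose_submatrix, ← Equiv.coe_refl, submatrix_mul_equiv, bipTensor,
    submatrix_mul_equiv, piKron_conjTranspose, piKron_mul, piKron_mul]
  simp only [this]

end BipTensor

/-! ### Separable states and operations that preserve them -/

section Separable

variable {a b a' b' : Type*} [Fintype a] [Fintype b] [Fintype a'] [Fintype b']

theorem IsDensity.kronecker {α : Matrix a a ℂ} {β : Matrix b b ℂ} (hα : IsDensity α)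
    (hβ : IsDensity β) : IsDensity (α ⊗ₖ β) := by
  classical
  exact ⟨hα.1.kronecker hβ.1, by rw [trace_kronecker, hα.2, hβ.2, mul_one]⟩

theorem IsDensity.isSeparable_kronecker {α : Matrix a a ℂ} {β : Matrix b b ℂ} (hα : IsDensity α)
    (hβ : IsDensity β) : IsSeparable (α ⊗ₖ β) :=
  subset_convexHull ℝ _ ⟨α, β, hα, hβ, rfl⟩

theorem convex_isDensity {n : Type*} [Fintype n] : Convex ℝ {ρ : Matrix n n ℂ | IsDensity ρ} := by
  intro x hx y hy s t hs ht hst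
  refine ⟨(hx.1.smul hs).add (hy.1.smul ht), ?_⟩
  rw [trace_add, trace_smul, trace_smul, hx.2, hy.2, ← add_smul, hst, one_smul]

theorem IsSeparable.isDensity {ω : Matrix (a × b) (a × b) ℂ} (hω : IsSeparable ω) :
    IsDensity ω := by
  refine convexHull_min (t := {ρ : Matrix (a × b) (a × b) ℂ | IsDensity ρ}) ?_
    convex_isDensity hω
  rintro _ ⟨α, β, hα, hβ, rfl⟩
  exact hα.kronecker hβ

/-- Real-linear maps sending product states to separable states preserve separability. -/
theorem IsSeparable.map (T : Matrix (a × b) (a × b) ℂ →ₗ[ℝ] Matrix (a' × b') (a' × b') ℂ)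
    (hT : ∀ α β, IsDensity α → IsDensity β → IsSeparable (T (α ⊗ₖ β)))
    {ω : Matrix (a × b) (a × b) ℂ} (hω : IsSeparable ω) : IsSeparable (T ω) := by
  refine convexHull_min (t := T ⁻¹' {τ | IsSeparable τ}) ?_
    ((convex_convexHull ℝ _).linear_preimage T) hω
  rintro _ ⟨α, β, hα, hβ, rfl⟩
  exact hT α β hα hβ

theorem IsDensity.conj {n m : Type*} [Fintype n] [Fintype m] [DecidableEq n] {Z : Matrix m n ℂ}
    {ρ : Matrix n n ℂ} (hρ : IsDensity ρ) (hZ : Zᴴ * Z = 1) : IsDensity (Z * ρ * Zᴴ) := by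
  refine ⟨hρ.1.mul_mul_conjTranspose_same Z, ?_⟩
  rw [Matrix.trace_mul_comm, ← Matrix.mul_assoc, hZ, Matrix.one_mul, hρ.2]

theorem isDensity_maximallyMixed (n : Type*) [Fintype n] [DecidableEq n] [Nonempty n] :
    IsDensity ((Fintype.card n : ℝ)⁻¹ • (1 : Matrix n n ℂ)) :=
  ⟨PosSemidef.one.smul (by positivity), by simp⟩

/-- Local isometries preserve separability. -/
theorem IsSeparable.conj_kronecker [DecidableEq a] [DecidableEq b] {E : Matrix a' a ℂ}
    {F : Matrix b' b ℂ} (hE : Eᴴ * E = 1)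
    (hF : Fᴴ * F = 1) {ω : Matrix (a × b) (a × b) ℂ} (hω : IsSeparable ω) :
    IsSeparable ((E ⊗ₖ F) * ω * (E ⊗ₖ F)ᴴ) := by
  let T : Matrix (a × b) (a × b) ℂ →ₗ[ℝ] Matrix (a' × b') (a' × b') ℂ :=
    { toFun := fun X => (E ⊗ₖ F) * X * (E ⊗ₖ F)ᴴ
      map_add' := fun X Y => by rw [Matrix.mul_add, Matrix.add_mul]
      map_smul' := fun c X => by simp }
  refine IsSeparable.map T (fun α β hα hβ => ?_) hω
  have : T (α ⊗ₖ β) = (E * α * Eᴴ) ⊗ₖ (F * β * Fᴴ) := by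
    change (E ⊗ₖ F) * (α ⊗ₖ β) * (E ⊗ₖ F)ᴴ = _
    rw [conjTranspose_kronecker, ← mul_kronecker_mul, ← mul_kronecker_mul]
  rw [this]
  exact (hα.conj hE).isSeparable_kronecker (hβ.conj hF)

theorem IsDensity.submatrix {n n' : Type*} [Fintype n] [Fintype n'] {ρ : Matrix n n ℂ}
    (h : IsDensity ρ) (e : n' ≃ n) : IsDensity (ρ.submatrix e e) :=
  ⟨h.1.submatrix e, by
    rw [← h.2]
    exact Fintype.sum_equiv e _ _ fun _ => rfl⟩

theorem IsSeparable.submatrix {ω : Matrix (a × b) (a × b) ℂ} (hω : IsSeparable ω) (e : a' ≃ a)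
    (f : b' ≃ b) : IsSeparable (ω.submatrix (e.prodCongr f) (e.prodCongr f)) := by
  let T : Matrix (a × b) (a × b) ℂ →ₗ[ℝ] Matrix (a' × b') (a' × b') ℂ :=
    { toFun := fun X => X.submatrix (e.prodCongr f) (e.prodCongr f)
      map_add' := fun X Y => rfl
      map_smul' := fun c X => rfl }
  exact IsSeparable.map T (fun α β hα hβ =>
    (hα.submatrix e).isSeparable_kronecker (hβ.submatrix f)) hω

theorem isSeparable_sum {K : Type*} [Fintype K] {c : K → ℝ} (hc : ∀ i, 0 ≤ c i)
    (hc1 : ∑ i, c i = 1) {ω : K → Matrix (a × b) (a × b) ℂ} (hω : ∀ i, IsSeparable (ω i)) :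
    IsSeparable (∑ i, c i • ω i) :=
  (convex_convexHull ℝ _).sum_mem (fun i _ => hc i) hc1 fun i _ => hω i

end Separable

section BipTensor

variable {ι : Type*} [Fintype ι] [DecidableEq ι] {a b : ι → Type*}
  [∀ i, Fintype (a i)] [∀ i, Fintype (b i)] [∀ i, DecidableEq (a i)] [∀ i, DecidableEq (b i)]

theorem piKron_update {n m : ι → Type*} (M : ∀ i, Matrix (n i) (m i) ℂ) (i : ι)
    (X : Matrix (n i) (m i) ℂ) (p : ∀ i, n i) (q : ∀ i, m i) :
    piKron (Function.update M i X) p q =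
      X (p i) (q i) * ∏ j ∈ Finset.univ.erase i, M j (p j) (q j) := by
  rw [piKron, of_apply, ← Finset.mul_prod_erase _ _ (Finset.mem_univ i), Function.update_self]
  congr 1
  refine Finset.prod_congr rfl fun j hj => ?_
  rw [Function.update_of_ne (Finset.ne_of_mem_erase hj)]

/-- The tensor product is linear in each factor, so factors can be reduced to product states one at
a time; s collects those not yet reduced. -/
theorem IsSeparable.bipTensor {ω : ∀ i, Matrix (a i × b i) (a i × b i) ℂ}
    (hω : ∀ i, IsSeparable (ω i)) : IsSeparable (bipTensor ω) := by
  suffices h : ∀ (s : Finset ι) (ω : ∀ i, Matrix (a i × b i) (a i × b i) ℂ),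
      (∀ i ∈ s, IsSeparable (ω i)) → (∀ i ∉ s, ∃ α β, IsDensity α ∧ IsDensity β ∧
        ω i = α ⊗ₖ β) → IsSeparable (QInfo.bipTensor ω) from
    h Finset.univ ω (fun i _ => hω i) fun i hi => absurd (Finset.mem_univ i) hi
  intro s
  induction s using Finset.induction_on with
  | empty =>
    intro ω _ h
    choose α β hα hβ h using fun i => h i (Finset.notMem_empty i)
    rw [show ω = fun i => α i ⊗ₖ β i from funext h, bipTensor_kronecker]
    exact (IsDensity.piKron hα).isSeparable_kronecker (IsDensity.piKron hβ)
  | insert i s hi ih =>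
    intro ω hs hns
    let T : Matrix (a i × b i) (a i × b i) ℂ →ₗ[ℝ]
        Matrix ((∀ i, a i) × (∀ i, b i)) ((∀ i, a i) × (∀ i, b i)) ℂ :=
      { toFun := fun X => QInfo.bipTensor (Function.update ω i X)
        map_add' := fun X Y => by
          ext p q
          simp only [QInfo.bipTensor, submatrix_apply, Matrix.add_apply, piKron_update, add_mul]
        map_smul' := fun c X => by
          ext p q
          simp only [QInfo.bipTensor, submatrix_apply, Matrix.smul_apply, piKron_update,
            RingHom.id_apply, smul_mul_assoc] }
    have hT : IsSeparable (T (ω i)) := by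
      refine IsSeparable.map T (fun α β hα hβ => ih _ (fun j hj => ?_) fun j hj => ?_)
        (hs i (Finset.mem_insert_self i s))
      · have hji : j ≠ i := fun h => hi (h ▸ hj)
        rw [Function.update_of_ne hji]
        exact hs j (Finset.mem_insert_of_mem hj)
      · by_cases hji : j = i
        · subst hji
          exact ⟨α, β, hα, hβ, Function.update_self ..⟩
        · rw [Function.update_of_ne hji]
          exact hns j (by simp [hji, hj])
    have : T (ω i) = QInfo.bipTensor ω := by
      change QInfo.bipTensor (Function.update ω i (ω i)) = _
      rw [Function.update_eq_self]
    rwa [this] at hT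

end BipTensor

/-! ### The relative entropy of entanglement as a real number -/

section RelEntEnt

variable {a b : Type*} [Fintype a] [Fintype b] [DecidableEq a] [DecidableEq b]

/-- The real number `Re (Tr ρ log ρ) - Re (Tr ρ log ω)`. -/
noncomputable def entropyGap {n : Type*} [Fintype n] [DecidableEq n] (ρ ω : Matrix n n ℂ) : ℝ :=
  (traceLog ρ ρ).re - (traceLog ρ ω).re

theorem relEntropy_of_support {n : Type*} [Fintype n] [DecidableEq n] {ρ ω : Matrix n n ℂ}
    (hs : ∀ v, ω *ᵥ v = 0 → ρ *ᵥ v = 0) : relEntropy ρ ω = (entropyGap ρ ω : EReal) := by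
  rw [relEntropy, if_pos hs]
  rfl

theorem relEntEnt_le {ρ ω : Matrix (a × b) (a × b) ℂ} (hω : IsSeparable ω)
    (hs : ∀ v, ω *ᵥ v = 0 → ρ *ᵥ v = 0) : relEntEnt ρ ≤ (entropyGap ρ ω : EReal) :=
  (iInf₂_le ω hω).trans_eq (relEntropy_of_support hs)

theorem exists_of_relEntEnt_lt {ρ : Matrix (a × b) (a × b) ℂ} {c : ℝ}
    (h : relEntEnt ρ < (c : EReal)) : ∃ ω, IsSeparable ω ∧
      (∀ v, ω *ᵥ v = 0 → ρ *ᵥ v = 0) ∧ entropyGap ρ ω < c := by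
  simp only [relEntEnt, iInf_lt_iff] at h
  obtain ⟨ω, hω, h⟩ := h
  by_cases hs : ∀ v, ω *ᵥ v = 0 → ρ *ᵥ v = 0
  · rw [relEntropy_of_support hs] at h
    exact ⟨ω, hω, hs, by exact_mod_cast h⟩
  · rw [relEntropy, if_neg hs] at h
    exact absurd h not_top_lt

/-- The eigenvalues of ω are at most 1, so Tr ρ log ω ≤ 0. This crude bound excludes the value -∞
and, being additive, bounds the rates from below. -/
theorem traceLog_le_relEntEnt {ρ : Matrix (a × b) (a × b) ℂ} (hρ : ρ.PosSemidef) :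
    ((traceLog ρ ρ).re : EReal) ≤ relEntEnt ρ := by
  refine le_iInf₂ fun ω hω => ?_
  by_cases hs : ∀ v, ω *ᵥ v = 0 → ρ *ᵥ v = 0
  · rw [relEntropy_of_support hs, EReal.coe_le_coe_iff, entropyGap, le_sub_self_iff]
    obtain ⟨V, w, h⟩ := exists_isSpectralForm hω.isDensity.1
    have hw : ∑ x, w x = 1 := by
      have := h.trace_eq
      exact_mod_cast this.symm.trans hω.isDensity.2
    rw [h.traceLog_eq, Complex.re_sum]
    refine Finset.sum_nonpos fun x _ => ?_
    have hp : (0 : ℂ) ≤ (Vᴴ * ρ * V) x x := (hρ.conjTranspose_mul_mul_same V).diag_nonneg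
    rw [Complex.re_ofReal_mul]
    refine mul_nonpos_of_nonpos_of_nonneg (Real.log_nonpos (h.pos x).le ?_) (Complex.le_def.1 hp).1
    rw [← hw]
    exact Finset.single_le_sum (fun y _ => (h.pos y).le) (Finset.mem_univ x)
  · rw [relEntropy, if_neg hs]
    exact le_top

/-- The maximally mixed state is a product state of full support. -/
theorem relEntEnt_ne_top {ρ : Matrix (a × b) (a × b) ℂ} (hρ : ρ.trace = 1) :
    relEntEnt ρ ≠ ⊤ := by
  have hne : Nonempty (a × b) := by
    by_contra h
    rw [not_nonempty_iff] at h
    simp [Matrix.trace] at hρ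
  have ha : Nonempty a := hne.map Prod.fst
  have hb : Nonempty b := hne.map Prod.snd
  refine ne_top_of_le_ne_top (EReal.coe_ne_top _)
    (relEntEnt_le ((isDensity_maximallyMixed a).isSeparable_kronecker
      (isDensity_maximallyMixed b)) fun v hv => ?_)
  rw [smul_kronecker, kronecker_smul, one_kronecker_one, smul_smul, smul_mulVec,
    one_mulVec] at hv
  have : v = 0 := (smul_eq_zero.1 hv).resolve_left (by positivity)
  rw [this, mulVec_zero]

/-- The relative entropy of entanglement of a density operator, as a real number. -/
noncomputable def entReal (ρ : Matrix (a × b) (a × b) ℂ) : ℝ := (relEntEnt ρ).toReal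

theorem coe_entReal {ρ : Matrix (a × b) (a × b) ℂ} (hρ : IsDensity ρ) :
    (entReal ρ : EReal) = relEntEnt ρ :=
  EReal.coe_toReal (relEntEnt_ne_top hρ.2)
    (ne_bot_of_le_ne_bot (EReal.coe_ne_bot _) (traceLog_le_relEntEnt hρ.1))

theorem traceLog_le_entReal {ρ : Matrix (a × b) (a × b) ℂ} (hρ : IsDensity ρ) :
    (traceLog ρ ρ).re ≤ entReal ρ := by
  rw [← EReal.coe_le_coe_iff, coe_entReal hρ]
  exact traceLog_le_relEntEnt hρ.1

theorem entReal_le {ρ ω : Matrix (a × b) (a × b) ℂ} (hρ : IsDensity ρ) (hω : IsSeparable ω)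
    (hs : ∀ v, ω *ᵥ v = 0 → ρ *ᵥ v = 0) : entReal ρ ≤ entropyGap ρ ω := by
  rw [← EReal.coe_le_coe_iff, coe_entReal hρ]
  exact relEntEnt_le hω hs

theorem exists_lt_entReal_add {ρ : Matrix (a × b) (a × b) ℂ} (hρ : IsDensity ρ) {ε : ℝ}
    (hε : 0 < ε) : ∃ ω, IsSeparable ω ∧ (∀ v, ω *ᵥ v = 0 → ρ *ᵥ v = 0) ∧
      entropyGap ρ ω < entReal ρ + ε := by
  refine exists_of_relEntEnt_lt ?_
  rw [← coe_entReal hρ, EReal.coe_lt_coe_iff]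
  linarith

theorem entReal_submatrix_le {a' b' : Type*} [Fintype a'] [Fintype b'] [DecidableEq a']
    [DecidableEq b'] {ρ : Matrix (a × b) (a × b) ℂ} (hρ : IsDensity ρ) (e : a' ≃ a)
    (f : b' ≃ b) : entReal (ρ.submatrix (e.prodCongr f) (e.prodCongr f)) ≤ entReal ρ := by
  refine le_of_forall_pos_le_add fun ε hε => ?_
  obtain ⟨ω, hω, hs, h⟩ := exists_lt_entReal_add hρ hε
  refine (entReal_le (hρ.submatrix _) (hω.submatrix e f) ?_).trans (le_trans (le_of_eq ?_) h.le)
  · obtain ⟨V, w, hV⟩ := exists_isSpectralForm hω.isDensity.1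
    refine ((hV.submatrix _).support_iff _).2 ?_
    rw [conjTranspose_submatrix, ← Equiv.coe_refl, submatrix_mul_equiv, submatrix_mul_equiv,
      (hV.support_iff _).1 hs]
  · rw [entropyGap, entropyGap, traceLog_submatrix hρ.1, traceLog_submatrix hω.isDensity.1]

theorem entReal_submatrix {a' b' : Type*} [Fintype a'] [Fintype b'] [DecidableEq a']
    [DecidableEq b'] {ρ : Matrix (a × b) (a × b) ℂ} (hρ : IsDensity ρ) (e : a' ≃ a)
    (f : b' ≃ b) : entReal (ρ.submatrix (e.prodCongr f) (e.prodCongr f)) = entReal ρ := by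
  refine le_antisymm (entReal_submatrix_le hρ e f) ?_
  have := entReal_submatrix_le (hρ.submatrix (e.prodCongr f)) e.symm f.symm
  rwa [submatrix_submatrix, show (⇑(e.prodCongr f) ∘ ⇑(e.symm.prodCongr f.symm)) = id from
    (e.prodCongr f).self_comp_symm, submatrix_id_id] at this

end RelEntEnt

/-- A tensor product of nearly optimal separable states is an admissible competitor, and the
relative entropy is additive on it. -/
theorem entReal_bipTensor_le {ι : Type*} [Fintype ι] [DecidableEq ι] {a b : ι → Type*}
    [∀ i, Fintype (a i)] [∀ i, Fintype (b i)] [∀ i, DecidableEq (a i)] [∀ i, DecidableEq (b i)]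
    {ρ : ∀ i, Matrix (a i × b i) (a i × b i) ℂ} (hρ : ∀ i, IsDensity (ρ i)) :
    entReal (bipTensor ρ) ≤ ∑ i, entReal (ρ i) := by
  refine le_of_forall_pos_le_add fun ε hε => ?_
  -- The added 1 covers an empty ι.
  have hε' : 0 < ε / (Fintype.card ι + 1) := by positivity
  choose ω hω hs h using fun i => exists_lt_entReal_add (hρ i) hε'
  refine (entReal_le (IsDensity.bipTensor hρ) (IsSeparable.bipTensor hω)
    (support_bipTensor (fun i => (hω i).isDensity.1) hs)).trans ?_
  rw [entropyGap, traceLog_bipTensor (fun i => (hω i).isDensity.1) hs fun i => (hρ i).2,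
    traceLog_bipTensor (fun i => (hρ i).1) (fun i v hv => hv) fun i => (hρ i).2, Complex.re_sum,
    Complex.re_sum, ← Finset.sum_sub_distrib]
  calc _ ≤ ∑ i, (entReal (ρ i) + ε / (Fintype.card ι + 1)) :=
        Finset.sum_le_sum fun i _ => (h i).le
    _ = ∑ i, entReal (ρ i) + ε * (Fintype.card ι / (Fintype.card ι + 1)) := by
        rw [Finset.sum_add_distrib]
        simp
        ring
    _ ≤ _ := by
        have : (Fintype.card ι : ℝ) / (Fintype.card ι + 1) ≤ 1 := by
          rw [div_le_one (by positivity)]; linarith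
        nlinarith

/-! ### Mixtures over mutually orthogonal local blocks -/

section BlockIsometry

variable {K n m : Type*} [Fintype K] [DecidableEq K] [Fintype n] [DecidableEq n] [Fintype m]
  [DecidableEq m] {k : K → Type*} [∀ w, Fintype (k w)] [∀ w, DecidableEq (k w)]

/-- The matrix whose columns are those of all the matrices of a family. -/
def joinColumns (V : ∀ w, Matrix n (k w) ℂ) : Matrix n (Σ w, k w) ℂ :=
  Matrix.of fun x p => V p.1 x p.2

theorem joinColumns_conj_apply (V : ∀ w, Matrix n (k w) ℂ) (ρ : Matrix n n ℂ) (p q : Σ w, k w) :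
    ((joinColumns V)ᴴ * ρ * joinColumns V) p q = ((V p.1)ᴴ * ρ * V q.1) p.2 q.2 := by
  simp only [Matrix.mul_apply, joinColumns, conjTranspose_apply, of_apply]

/-- An equal-weight mixture of mutually orthogonal copies of operators in spectral form. -/
theorem IsSpectralForm.joinColumns [Nonempty K] {S : K → Matrix n m ℂ}
    (hS : ∀ w, (S w)ᴴ * S w = 1) (horth : ∀ w w', w ≠ w' → (S w)ᴴ * S w' = 0)
    {ω : K → Matrix m m ℂ} {V : ∀ w, Matrix m (k w) ℂ} {r : ∀ w, k w → ℝ}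
    (h : ∀ w, IsSpectralForm (ω w) (V w) (r w)) :
    IsSpectralForm (∑ w, (Fintype.card K : ℝ)⁻¹ • (S w * ω w * (S w)ᴴ))
      (joinColumns fun w => S w * V w) (fun p => (Fintype.card K : ℝ)⁻¹ * r p.1 p.2) where
  isometry := by
    ext ⟨w, x⟩ ⟨w', x'⟩
    have := joinColumns_conj_apply (fun w => S w * V w) 1 ⟨w, x⟩ ⟨w', x'⟩
    simp only [Matrix.mul_one] at this
    rw [this, conjTranspose_mul, Matrix.mul_assoc, ← Matrix.mul_assoc (S w)ᴴ]
    by_cases hw : w = w'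
    · subst hw
      rw [hS, Matrix.one_mul, (h w).isometry, Matrix.one_apply, Matrix.one_apply]
      simp
    · rw [horth w w' hw, Matrix.zero_mul, Matrix.mul_zero, Matrix.one_apply_ne (by simp [hw])]
      rfl
  pos := fun p => mul_pos (by positivity) ((h p.1).pos p.2)
  eq := by
    ext i j
    rw [mul_diagonal_conjTranspose_apply, Fintype.sum_sigma, Matrix.sum_apply]
    refine Finset.sum_congr rfl fun w _ => ?_
    have : S w * ω w * (S w)ᴴ = (S w * V w) * diagonal (fun x => (r w x : ℂ)) * (S w * V w)ᴴ := by
      rw [(h w).eq, conjTranspose_mul]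
      simp only [Matrix.mul_assoc]
    rw [Matrix.smul_apply, this, mul_diagonal_conjTranspose_apply, Finset.smul_sum]
    refine Finset.sum_congr rfl fun x _ => ?_
    simp only [QInfo.joinColumns, of_apply, Complex.real_smul]
    push_cast
    ring

/-- If v is orthogonal to all columns, then ω_w, hence τ_w, kills S_w†v. The quadratic form of ρ
therefore vanishes at S_w S_w†v, and positivity makes ρ kill this vector. Summing over w gives ρv =
0 by `hsum`. -/
theorem support_joinColumns {S : K → Matrix n m ℂ} {ω τ : K → Matrix m m ℂ}
    {V : ∀ w, Matrix m (k w) ℂ} {r : ∀ w, k w → ℝ}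
    (h : ∀ w, IsSpectralForm (ω w) (V w) (r w)) {ρ : Matrix n n ℂ} (hρ : ρ.PosSemidef) {c : ℝ}
    (hτ : ∀ w, (S w)ᴴ * ρ * S w = c • τ w) (hsum : ρ * ∑ w, S w * (S w)ᴴ = ρ)
    (hs : ∀ w v, ω w *ᵥ v = 0 → τ w *ᵥ v = 0) (v : n → ℂ)
    (hv : (joinColumns fun w => S w * V w)ᴴ *ᵥ v = 0) : ρ *ᵥ v = 0 := by
  have h0 : ∀ w, ρ *ᵥ ((S w * (S w)ᴴ) *ᵥ v) = 0 := fun w => by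
    have h1 : (V w)ᴴ *ᵥ ((S w)ᴴ *ᵥ v) = 0 := by
      rw [Matrix.mulVec_mulVec, ← conjTranspose_mul]
      funext x
      exact congrFun hv ⟨w, x⟩
    have h2 := hs w _ (((h w).mulVec_eq_zero_iff _).2 h1)
    have h3 : ((S w)ᴴ * ρ * S w) *ᵥ ((S w)ᴴ *ᵥ v) = 0 := by
      rw [hτ, smul_mulVec, h2, smul_zero]
    rw [← hρ.dotProduct_mulVec_zero_iff]
    have h4 : star ((S w)ᴴ *ᵥ v) ⬝ᵥ (((S w)ᴴ * ρ * S w) *ᵥ ((S w)ᴴ *ᵥ v)) = 0 := by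
      rw [h3, dotProduct_zero]
    rw [← h4, ← Matrix.mulVec_mulVec, star_mulVec, ← dotProduct_mulVec]
    simp only [Matrix.mulVec_mulVec, Matrix.mul_assoc]
  rw [← hsum, ← Matrix.mulVec_mulVec, Matrix.sum_mulVec, Matrix.mulVec_sum]
  exact Finset.sum_eq_zero fun w _ => h0 w

end BlockIsometry

variable {K α β a b : Type*} [Fintype K] [DecidableEq K] [Nonempty K] [Fintype α] [Fintype β]
  [Fintype a] [Fintype b] [DecidableEq α] [DecidableEq β] [DecidableEq a] [DecidableEq b]

/-- A state whose compressions by mutually orthogonal local isometries are equally weighted states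
of the same entropy as the whole. -/
theorem entReal_le_log_card_add {E : K → Matrix α a ℂ} {F : K → Matrix β b ℂ}
    (hE : ∀ w, (E w)ᴴ * E w = 1) (hF : ∀ w, (F w)ᴴ * F w = 1)
    (horth : ∀ w w', w ≠ w' → (E w ⊗ₖ F w)ᴴ * (E w' ⊗ₖ F w') = 0)
    {ρ : Matrix (α × β) (α × β) ℂ} (hρ : IsDensity ρ) {τ : K → Matrix (a × b) (a × b) ℂ}
    (hτd : ∀ w, IsDensity (τ w))
    (hτ : ∀ w, (E w ⊗ₖ F w)ᴴ * ρ * (E w ⊗ₖ F w) = (Fintype.card K : ℝ)⁻¹ • τ w)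
    (hsum : ρ * ∑ w, (E w ⊗ₖ F w) * (E w ⊗ₖ F w)ᴴ = ρ)
    (hent : ∀ w, traceLog (τ w) (τ w) = traceLog ρ ρ) :
    entReal ρ ≤ Real.log (Fintype.card K) + (Fintype.card K : ℝ)⁻¹ * ∑ w, entReal (τ w) := by
  refine le_of_forall_pos_le_add fun ε hε => ?_
  -- The same ε serves every block, since the block weights sum to 1.
  choose ω hω hs h using fun w => exists_lt_entReal_add (hτd w) hε
  choose V r hV using fun w => exists_isSpectralForm (hω w).isDensity.1
  set S := fun w => E w ⊗ₖ F w with hSdef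
  have hS : ∀ w, (S w)ᴴ * S w = 1 := fun w => by
    rw [hSdef, conjTranspose_kronecker, ← mul_kronecker_mul, hE, hF, one_kronecker_one]
  have hcard : (Fintype.card K : ℝ) ≠ 0 := by positivity
  have hsp := IsSpectralForm.joinColumns hS horth hV
  have hsep : IsSeparable (∑ w, (Fintype.card K : ℝ)⁻¹ • (S w * ω w * (S w)ᴴ)) :=
    isSeparable_sum (fun _ => by positivity) (by simp [hcard])
      fun w => (hω w).conj_kronecker (hE w) (hF w)
  refine (entReal_le hρ hsep fun v hv => support_joinColumns hV hρ.1 hτ hsum hs v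
    ((hsp.mulVec_eq_zero_iff v).1 hv)).trans ?_
  set c : ℝ := (Fintype.card K : ℝ)⁻¹ with hc
  have hcpos : 0 < c := by positivity
  -- The mixture has eigenvalues c · r, and its logarithm is block diagonal: only the compressions c
  -- τ_w of ρ enter, and log c splits off.
  have hlog : traceLog ρ (∑ w, c • (S w * ω w * (S w)ᴴ)) =
      ∑ w, (c : ℂ) * ((Real.log c : ℂ) + traceLog (τ w) (ω w)) := by
    rw [hsp.traceLog_eq, Fintype.sum_sigma]
    refine Finset.sum_congr rfl fun w _ => ?_
    have htr : ∑ x, ((V w)ᴴ * τ w * V w) x x = 1 :=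
      (IsSpectralForm.trace_conj (((hV w).support_iff _).1 (hs w))).trans (hτd w).2
    have hdiag : ∀ x, ((joinColumns fun w => S w * V w)ᴴ * ρ * joinColumns fun w => S w * V w)
        ⟨w, x⟩ ⟨w, x⟩ = (c : ℂ) * ((V w)ᴴ * τ w * V w) x x := fun x => by
      rw [joinColumns_conj_apply, conjTranspose_mul]
      have : (V w)ᴴ * (S w)ᴴ * ρ * (S w * V w) = (V w)ᴴ * ((S w)ᴴ * ρ * S w) * V w := by
        simp only [Matrix.mul_assoc]
      rw [this, hτ, Matrix.mul_smul, Matrix.smul_mul, Matrix.smul_apply, Complex.real_smul]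
    rw [(hV w).traceLog_eq]
    calc _ = ∑ x, ((c : ℂ) * ((Real.log c : ℂ) * ((V w)ᴴ * τ w * V w) x x) +
          c * ((Real.log (r w x) : ℂ) * ((V w)ᴴ * τ w * V w) x x)) := by
          refine Finset.sum_congr rfl fun x _ => ?_
          rw [hdiag, Real.log_mul hcpos.ne' ((hV w).pos x).ne']
          push_cast
          ring
      _ = _ := by
          rw [Finset.sum_add_distrib, ← Finset.mul_sum, ← Finset.mul_sum, ← Finset.mul_sum, htr]
          ring
  have hsumc : ∑ _w : K, c = 1 := by simp [hc, hcard]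
  have hre : (traceLog ρ (∑ w, c • (S w * ω w * (S w)ᴴ))).re =
      ∑ w, c * (Real.log c + (traceLog (τ w) (ω w)).re) := by
    rw [hlog, Complex.re_sum]
    simp
  calc entropyGap ρ (∑ w, c • (S w * ω w * (S w)ᴴ))
      = ∑ w, c * (entropyGap (τ w) (ω w) - Real.log c) := by
        -- Tr ρ log ρ is spread over the blocks with weights c, so that `hent` can replace it by Tr
        -- τ_w log τ_w in each.
        rw [entropyGap, hre, ← one_mul (traceLog ρ ρ).re, ← hsumc, Finset.sum_mul,
          ← Finset.sum_sub_distrib]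
        refine Finset.sum_congr rfl fun w _ => ?_
        rw [entropyGap, hent]
        ring
    _ ≤ ∑ w, c * (entReal (τ w) + ε - Real.log c) :=
        Finset.sum_le_sum fun w _ => by gcongr; exact (h w).le
    _ = Real.log (Fintype.card K) + c * ∑ w, entReal (τ w) + ε := by
        have : ∀ w, c * (entReal (τ w) + ε - Real.log c) =
          c * entReal (τ w) + c * (ε - Real.log c) := fun w => by ring
        simp only [this]
        rw [Finset.sum_add_distrib, ← Finset.mul_sum, ← Finset.sum_mul, hsumc, hc, Real.log_inv]
        ring

section BipTensor

variable {ι : Type*} [Fintype ι] [DecidableEq ι] {a b c e : ι → Type*}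

theorem bipTensor_apply (M : ∀ i, Matrix (a i × b i) (c i × e i) ℂ)
    (p : (∀ i, a i) × (∀ i, b i)) (q : (∀ i, c i) × (∀ i, e i)) :
    bipTensor M p q = ∏ i, M i (p.1 i, p.2 i) (q.1 i, q.2 i) := rfl

theorem bipTensor_smul (r : ℝ) (M : ∀ i, Matrix (a i × b i) (c i × e i) ℂ) :
    bipTensor (fun i => r • M i) = r ^ Fintype.card ι • bipTensor M := by
  ext p q
  simp only [bipTensor_apply, Matrix.smul_apply, Complex.real_smul, Finset.prod_mul_distrib]
  simp

theorem bipTensor_eq_zero {M : ∀ i, Matrix (a i × b i) (c i × e i) ℂ} {i : ι} (h : M i = 0) :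
    bipTensor M = 0 := by
  ext p q
  exact Finset.prod_eq_zero (Finset.mem_univ i) (by simp [h])

theorem bipTensor_sum {κ : Type*} [Fintype κ] (M : ∀ i, κ → Matrix (a i × b i) (c i × e i) ℂ) :
    bipTensor (fun i => ∑ x, M i x) = ∑ w : ι → κ, bipTensor fun i => M i (w i) := by
  ext p q
  simp only [bipTensor_apply, Matrix.sum_apply, Fintype.prod_sum]

theorem piKron_isometry {n m : ι → Type*} [∀ i, Fintype (n i)] [∀ i, DecidableEq (m i)]
    {M : ∀ i, Matrix (n i) (m i) ℂ} (h : ∀ i, (M i)ᴴ * M i = 1) :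
    (piKron M)ᴴ * piKron M = 1 := by
  rw [piKron_conjTranspose, piKron_mul]
  simp only [h, piKron_one]

end BipTensor

/-! ### The private state as an isometric image of the shield state -/

section PrivateState

variable {d : ℕ} {a b : Type*} [Fintype a] [Fintype b] [DecidableEq a] [DecidableEq b]

/-- The local isometry that adjoins the `i`-th vector of a basis of the key system. -/
noncomputable def keyIsometry (a : Type*) [DecidableEq a]
    (e : OrthonormalBasis (Fin d) ℂ (EuclideanSpace ℂ (Fin d))) (i : Fin d) :
    Matrix (Fin d × a) a ℂ :=
  Matrix.of fun p u => e i p.1 * (1 : Matrix a a ℂ) p.2 u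

theorem keyIsometry_mul (e : OrthonormalBasis (Fin d) ℂ (EuclideanSpace ℂ (Fin d)))
    (i j : Fin d) : (keyIsometry a e i)ᴴ * keyIsometry a e j = if i = j then 1 else 0 := by
  have h := orthonormal_iff_ite.1 e.orthonormal i j
  rw [EuclideanSpace.inner_eq_star_dotProduct, dotProduct] at h
  ext u v
  have : ((keyIsometry a e i)ᴴ * keyIsometry a e j) u v =
      (if i = j then (1 : ℂ) else 0) * (1 : Matrix a a ℂ) u v := by
    rw [← h, Matrix.mul_apply, Fintype.sum_prod_type, Finset.sum_mul]
    refine Finset.sum_congr rfl fun x _ => ?_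
    simp only [keyIsometry, Matrix.one_apply, conjTranspose_apply, of_apply]
    rw [Finset.sum_eq_single u (fun y _ hy => by simp [hy]) (by simp)]
    by_cases huv : u = v
    · simp only [huv, if_true, mul_one]
      exact mul_comm _ _
    · simp only [huv, if_false, mul_zero]
  rw [this]
  split_ifs <;> simp

theorem keyIsometry_isometry (e : OrthonormalBasis (Fin d) ℂ (EuclideanSpace ℂ (Fin d)))
    (i : Fin d) : (keyIsometry a e i)ᴴ * keyIsometry a e i = 1 := by
  rw [keyIsometry_mul, if_pos rfl]

variable (e f : OrthonormalBasis (Fin d) ℂ (EuclideanSpace ℂ (Fin d)))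

/-- The local isometry that adjoins the key vector `e_i ⊗ f_i`. -/
noncomputable def keyPairIsometry (a b : Type*) [DecidableEq a] [DecidableEq b] (i : Fin d) :
    Matrix ((Fin d × a) × (Fin d × b)) (a × b) ℂ :=
  keyIsometry a e i ⊗ₖ keyIsometry b f i

theorem keyPairIsometry_mul (i j : Fin d) :
    (keyPairIsometry e f a b i)ᴴ * keyPairIsometry e f a b j = if i = j then 1 else 0 := by
  rw [keyPairIsometry, keyPairIsometry, conjTranspose_kronecker, ← mul_kronecker_mul,
    keyIsometry_mul, keyIsometry_mul]
  split_ifs <;> simp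

variable (U : Fin d → Matrix.unitaryGroup (a × b) ℂ) (σ : Matrix (a × b) (a × b) ℂ)

/-- The isometry carrying the shield state to the private state. -/
noncomputable def twistIsometry : Matrix ((Fin d × a) × (Fin d × b)) (a × b) ℂ :=
  (Real.sqrt d)⁻¹ • ∑ i, keyPairIsometry e f a b i * (U i : Matrix (a × b) (a × b) ℂ)

/-- Orthonormality of the key vectors isolates a single branch of the superposition. -/
theorem keyPairIsometry_mul_twistIsometry (i : Fin d) :
    (keyPairIsometry e f a b i)ᴴ * twistIsometry e f U =
      (Real.sqrt d)⁻¹ • (U i : Matrix (a × b) (a × b) ℂ) := by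
  rw [twistIsometry, Matrix.mul_smul, Matrix.mul_sum]
  simp only [← Matrix.mul_assoc, keyPairIsometry_mul]
  simp

/-- The range of the twist lies in the span of the correlated key vectors e_i ⊗ f_i, so γ loses
nothing under the projection onto these blocks. -/
theorem sum_mul_twistIsometry :
    (∑ i, keyPairIsometry e f a b i * (keyPairIsometry e f a b i)ᴴ) * twistIsometry e f U =
      twistIsometry e f U := by
  simp only [Matrix.sum_mul, Matrix.mul_assoc, keyPairIsometry_mul_twistIsometry]
  rw [twistIsometry, Finset.smul_sum]
  simp

theorem twistIsometry_isometry (hd : 1 ≤ d) :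
    (twistIsometry e f U)ᴴ * twistIsometry e f U = 1 := by
  have hd' : (d : ℝ) ≠ 0 := by positivity
  -- Only the adjoint stays expanded; the right factor is folded back so that
  -- `keyPairIsometry_mul_twistIsometry` applies.
  conv_lhs => rw [twistIsometry, conjTranspose_smul, conjTranspose_sum, Matrix.smul_mul,
    Matrix.sum_mul, ← twistIsometry]
  simp only [conjTranspose_mul, Matrix.mul_assoc, keyPairIsometry_mul_twistIsometry]
  have hU : ∀ i, (U i : Matrix (a × b) (a × b) ℂ)ᴴ * (U i : Matrix (a × b) (a × b) ℂ) = 1 :=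
    fun i => Unitary.coe_star_mul_self _
  have hs : (Real.sqrt d)⁻¹ * (d : ℝ) * (Real.sqrt d)⁻¹ = 1 := by
    have := Real.mul_self_sqrt (Nat.cast_nonneg (α := ℝ) d)
    have h0 : Real.sqrt d ≠ 0 := by positivity
    field_simp
    nlinarith
  simp only [Matrix.mul_smul, hU, Finset.sum_const, Finset.card_univ, Fintype.card_fin,
    star_trivial]
  rw [← Nat.cast_smul_eq_nsmul ℝ, smul_smul, smul_smul, hs, one_smul]

theorem privateState_eq :
    privateState e f U σ = twistIsometry e f U * σ * (twistIsometry e f U)ᴴ := by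
  have hs : (Real.sqrt d)⁻¹ * (Real.sqrt d)⁻¹ = (1 / d : ℝ) := by
    rw [← mul_inv, Real.mul_self_sqrt (Nat.cast_nonneg _), one_div]
  have h : twistIsometry e f U * σ * (twistIsometry e f U)ᴴ = (1 / d : ℝ) •
      ∑ i, ∑ j, keyPairIsometry e f a b i * ((U i : Matrix (a × b) (a × b) ℂ) * σ *
        (U j : Matrix (a × b) (a × b) ℂ)ᴴ) * (keyPairIsometry e f a b j)ᴴ := by
    rw [twistIsometry, conjTranspose_smul, conjTranspose_sum, Matrix.smul_mul, Matrix.smul_mul,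
      Matrix.mul_smul, smul_smul, star_trivial, hs, Matrix.sum_mul, Matrix.sum_mul]
    congr 1
    refine Finset.sum_congr rfl fun i _ => ?_
    rw [Matrix.mul_sum]
    refine Finset.sum_congr rfl fun j _ => ?_
    rw [conjTranspose_mul]
    simp only [Matrix.mul_assoc]
  have hkey : ∀ i (p : (Fin d × a) × (Fin d × b)) u, keyPairIsometry e f a b i p u =
      (e i p.1.1 * f i p.2.1) * (1 : Matrix (a × b) (a × b) ℂ) (p.1.2, p.2.2) u := by
    rintro i p ⟨u, v⟩
    rw [← one_kronecker_one]
    simp only [keyPairIsometry, keyIsometry, kroneckerMap_apply, of_apply]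
    ring
  have hl : ∀ i (M : Matrix (a × b) (a × b) ℂ) p u, (keyPairIsometry e f a b i * M) p u =
      (e i p.1.1 * f i p.2.1) * M (p.1.2, p.2.2) u := by
    intro i M p u
    rw [Matrix.mul_apply]
    simp only [hkey, mul_assoc]
    rw [← Finset.mul_sum, ← Finset.mul_sum, ← Matrix.mul_apply, Matrix.one_mul]
  have hr : ∀ j (M : Matrix ((Fin d × a) × (Fin d × b)) (a × b) ℂ) p q,
      (M * (keyPairIsometry e f a b j)ᴴ) p q =
      star (e j q.1.1 * f j q.2.1) * M p (q.1.2, q.2.2) := by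
    intro j M p q
    have : (M * (keyPairIsometry e f a b j)ᴴ) p q =
        star ((keyPairIsometry e f a b j * Mᴴ) q p) := by
      rw [← conjTranspose_apply, conjTranspose_mul, conjTranspose_conjTranspose]
    rw [this]
    simp only [Matrix.mul_apply, hkey]
    have h2 : ∀ x, e j q.1.1 * f j q.2.1 * (1 : Matrix (a × b) (a × b) ℂ) (q.1.2, q.2.2) x *
        Mᴴ x p = (e j q.1.1 * f j q.2.1) * ((1 : Matrix (a × b) (a × b) ℂ) (q.1.2, q.2.2) x *
        Mᴴ x p) := fun x => mul_assoc _ _ _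
    simp only [h2]
    rw [← Finset.mul_sum, ← Matrix.mul_apply, Matrix.one_mul, star_mul', conjTranspose_apply,
      star_star]
  rw [h]
  ext p q
  rw [privateState, of_apply, Matrix.smul_apply, Complex.real_smul, Matrix.sum_apply]
  congr 1
  · push_cast; rfl
  refine Finset.sum_congr rfl fun i _ => ?_
  rw [Matrix.sum_apply]
  refine Finset.sum_congr rfl fun j _ => ?_
  rw [hr, hl]
  ring

variable {σ}

theorem IsDensity.conditionalState (hσ : IsDensity σ) (i : Fin d) :
    IsDensity (conditionalState U σ i) :=
  hσ.conj (Unitary.coe_star_mul_self _)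

theorem IsDensity.privateState (hd : 1 ≤ d) (hσ : IsDensity σ) :
    IsDensity (privateState e f U σ) := by
  rw [privateState_eq]
  exact hσ.conj (twistIsometry_isometry e f U hd)

theorem IsDensity.tensorFamily {ι : Type*} [Fintype ι] [DecidableEq ι]
    {ρ : ι → Matrix (a × b) (a × b) ℂ} (hρ : ∀ i, IsDensity (ρ i)) :
    IsDensity (tensorFamily ρ) :=
  IsDensity.bipTensor (a := fun _ => a) (b := fun _ => b) hρ

theorem traceLog_tensorFamily {ι : Type*} [Fintype ι] [DecidableEq ι]
    {ρ : ι → Matrix (a × b) (a × b) ℂ} (hρ : ∀ i, IsDensity (ρ i)) :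
    traceLog (tensorFamily ρ) (tensorFamily ρ) = ∑ i, traceLog (ρ i) (ρ i) :=
  traceLog_bipTensor (a := fun _ => a) (b := fun _ => b) (fun i => (hρ i).1)
    (fun _ _ h => h) fun i => (hρ i).2

/-- The blocks are indexed by the d^n key words. Orthogonality holds because two distinct words
differ at some position, and all the entropies involved equal n times that of σ. -/
theorem entReal_tensorPower_privateState_le (hd : 1 ≤ d) (hσ : IsDensity σ) (n : ℕ) :
    entReal (tensorPower (privateState e f U σ) n) ≤ n * Real.log d +
      ((d : ℝ) ^ n)⁻¹ * ∑ w : Fin n → Fin d,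
        entReal (tensorFamily fun k => conditionalState U σ (w k)) := by
  have hne : Nonempty (Fin d) := ⟨⟨0, hd⟩⟩
  have hS : ∀ w : Fin n → Fin d,
      (piKron fun k => keyIsometry a e (w k)) ⊗ₖ (piKron fun k => keyIsometry b f (w k)) =
      bipTensor fun k => keyPairIsometry e f a b (w k) := fun w => (bipTensor_kronecker _ _).symm
  have hγ : tensorPower (privateState e f U σ) n = bipTensor (a := fun _ => Fin d × a)
      (b := fun _ => Fin d × b) (c := fun _ => Fin d × a) (e := fun _ => Fin d × b)
      fun _ : Fin n => privateState e f U σ := rfl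
  have hcomp : ∀ i, (keyPairIsometry e f a b i)ᴴ * privateState e f U σ *
      keyPairIsometry e f a b i = (d : ℝ)⁻¹ • conditionalState U σ i := fun i => by
    have h1 := keyPairIsometry_mul_twistIsometry e f U i
    have h2 := congrArg conjTranspose h1
    rw [conjTranspose_mul, conjTranspose_conjTranspose, conjTranspose_smul, star_trivial] at h2
    rw [privateState_eq]
    calc _ = ((keyPairIsometry e f a b i)ᴴ * twistIsometry e f U) * σ *
          ((twistIsometry e f U)ᴴ * keyPairIsometry e f a b i) := by simp only [Matrix.mul_assoc]
      _ = _ := by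
        rw [h1, h2, Matrix.smul_mul, Matrix.smul_mul, Matrix.mul_smul, smul_smul, ← mul_inv,
          Real.mul_self_sqrt (Nat.cast_nonneg _)]
        rfl
  have key := entReal_le_log_card_add (K := Fin n → Fin d)
    (E := fun w => piKron fun k => keyIsometry a e (w k))
    (F := fun w => piKron fun k => keyIsometry b f (w k))
    (ρ := tensorPower (privateState e f U σ) n)
    (τ := fun w => tensorFamily fun k => conditionalState U σ (w k))
    (fun w => piKron_isometry fun k => keyIsometry_isometry e (w k))
    (fun w => piKron_isometry fun k => keyIsometry_isometry f (w k)) ?_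
    (IsDensity.tensorFamily fun _ => IsDensity.privateState e f U hd hσ)
    (fun w => IsDensity.tensorFamily fun k => IsDensity.conditionalState U hσ (w k)) ?_ ?_ ?_
  · simpa using key
  · intro w w' hw
    obtain ⟨k, hk⟩ := Function.ne_iff.1 hw
    rw [hS, hS, bipTensor_conjTranspose, bipTensor_mul]
    exact bipTensor_eq_zero (i := k) (by rw [keyPairIsometry_mul, if_neg hk])
  · intro w
    rw [hS, hγ, bipTensor_conjTranspose, bipTensor_mul, bipTensor_mul]
    simp only [hcomp]
    rw [bipTensor_smul, tensorFamily_eq_bipTensor]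
    simp
  · simp only [hS, bipTensor_conjTranspose, bipTensor_mul]
    rw [← bipTensor_sum (fun (_ : Fin n) i => keyPairIsometry e f a b i *
      (keyPairIsometry e f a b i)ᴴ), hγ, bipTensor_mul]
    congr 1
    funext _
    have h2 := congrArg conjTranspose (sum_mul_twistIsometry e f U)
    rw [conjTranspose_mul, conjTranspose_sum] at h2
    simp only [conjTranspose_mul, conjTranspose_conjTranspose] at h2
    rw [privateState_eq, Matrix.mul_assoc, h2]
  · intro w
    rw [tensorPower, traceLog_tensorFamily fun k => IsDensity.conditionalState U hσ (w k),
      traceLog_tensorFamily fun _ => IsDensity.privateState e f U hd hσ]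
    refine Finset.sum_congr rfl fun k _ => ?_
    rw [privateState_eq, traceLog_conj hσ.1 (twistIsometry_isometry e f U hd)]
    exact traceLog_conj hσ.1 (Unitary.coe_star_mul_self _)

end PrivateState

/-! ### Regrouping tensor factors and subadditivity -/

section Regrouping

variable {ι : Type*} [Fintype ι] [DecidableEq ι] {a b : Type*} [Fintype a] [Fintype b]
  [DecidableEq a] [DecidableEq b]

theorem entReal_tensorFamily_le {ρ : ι → Matrix (a × b) (a × b) ℂ} (hρ : ∀ i, IsDensity (ρ i)) :
    entReal (tensorFamily ρ) ≤ ∑ i, entReal (ρ i) :=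
  entReal_bipTensor_le (a := fun _ => a) (b := fun _ => b) hρ

theorem entReal_tensorFamily_comp {κ : Type*} [Fintype κ] [DecidableEq κ]
    {ρ : ι → Matrix (a × b) (a × b) ℂ} (hρ : ∀ i, IsDensity (ρ i)) (e : κ ≃ ι) :
    entReal (tensorFamily fun k => ρ (e k)) = entReal (tensorFamily ρ) := by
  rw [← entReal_submatrix (IsDensity.tensorFamily hρ) (e.arrowCongr (Equiv.refl a))
    (e.arrowCongr (Equiv.refl b))]
  congr 1
  ext p q
  simp only [tensorFamily, of_apply, submatrix_apply]
  exact Fintype.prod_equiv e _ _ fun k => by simp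

theorem entReal_tensorFamily_const {κ : Type*} [Fintype κ] [DecidableEq κ]
    {ρ : Matrix (a × b) (a × b) ℂ} (hρ : IsDensity ρ) {n : ℕ} (hn : Fintype.card κ = n) :
    entReal (tensorFamily fun _ : κ => ρ) = entReal (tensorPower ρ n) :=
  entReal_tensorFamily_comp (fun _ => hρ) (Fintype.equivFinOfCardEq hn)

/-- Regrouping of the coordinates of a tuple along the fibers of a map. -/
def fiberPi {X : Type*} (g : ι → X) (c : Type*) : (ι → c) ≃ (∀ x, {i // g i = x} → c) where
  toFun p _ i := p i
  invFun q i := q (g i) ⟨i, rfl⟩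
  left_inv _ := rfl
  right_inv q := by
    funext x ⟨i, h⟩
    subst h
    rfl

/-- Grouping factors by the value of g merely relabels each party's indices, after which
subadditivity over the groups applies. -/
theorem entReal_tensorFamily_le_sum_fiber {X : Type*} [Fintype X] [DecidableEq X] (g : ι → X)
    {ρ : ι → Matrix (a × b) (a × b) ℂ} (hρ : ∀ i, IsDensity (ρ i)) :
    entReal (tensorFamily ρ) ≤
      ∑ x, entReal (tensorFamily fun i : {i // g i = x} => ρ i) := by
  have hd : ∀ x, IsDensity (tensorFamily fun i : {i // g i = x} => ρ i) :=
    fun x => IsDensity.tensorFamily fun i => hρ i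
  refine le_trans (le_of_eq ?_) (entReal_bipTensor_le (a := fun x => {i // g i = x} → a)
    (b := fun x => {i // g i = x} → b) hd)
  rw [← entReal_submatrix (IsDensity.bipTensor (a := fun x => {i // g i = x} → a)
    (b := fun x => {i // g i = x} → b) hd) (fiberPi g a) (fiberPi g b)]
  congr 1
  ext p q
  simp only [tensorFamily, of_apply, submatrix_apply, bipTensor_apply]
  rw [← Fintype.prod_fiberwise g]
  rfl

theorem entReal_tensorPower_tensorFamily {ρ : ι → Matrix (a × b) (a × b) ℂ}
    (hρ : ∀ i, IsDensity (ρ i)) (n : ℕ) :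
    entReal (tensorPower (tensorFamily ρ) n) =
      entReal (tensorFamily fun x : Fin n × ι => ρ x.2) := by
  rw [← entReal_submatrix (IsDensity.tensorFamily fun x : Fin n × ι => hρ x.2)
    (Equiv.curry (Fin n) ι a).symm (Equiv.curry (Fin n) ι b).symm]
  congr 1
  ext p q
  simp only [tensorPower, tensorFamily, of_apply, submatrix_apply, Fintype.prod_prod_type]
  rfl

theorem subadditive_entReal_tensorPower {ρ : Matrix (a × b) (a × b) ℂ} (hρ : IsDensity ρ) :
    Subadditive fun n => entReal (tensorPower ρ n) := by
  intro m n
  change entReal (tensorPower ρ (m + n)) ≤ entReal (tensorPower ρ m) + entReal (tensorPower ρ n)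
  rw [← entReal_tensorFamily_const (κ := Fin m ⊕ Fin n) hρ (by simp)]
  refine (entReal_tensorFamily_le_sum_fiber Sum.isLeft fun _ => hρ).trans_eq ?_
  rw [Fintype.sum_bool, entReal_tensorFamily_const hρ, entReal_tensorFamily_const hρ]
  · let e : {x : Fin m ⊕ Fin n // x.isLeft = false} ≃ Fin n :=
      { toFun := fun x => x.1.getRight (by simpa using x.2)
        invFun := fun i => ⟨Sum.inr i, rfl⟩
        left_inv := by
          rintro ⟨x | x, h⟩
          · cases h
          · rfl
        right_inv := fun _ => rfl }
    rw [Fintype.card_congr e, Fintype.card_fin]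
  · rw [Fintype.card_congr Equiv.sumIsLeft, Fintype.card_fin]

theorem entReal_tensorPower_tensorFamily_le {ρ : ι → Matrix (a × b) (a × b) ℂ}
    (hρ : ∀ i, IsDensity (ρ i)) (n : ℕ) :
    entReal (tensorPower (tensorFamily ρ) n) ≤ ∑ i, entReal (tensorPower (ρ i) n) := by
  rw [entReal_tensorPower_tensorFamily hρ]
  refine (entReal_tensorFamily_le_sum_fiber Prod.snd fun x => hρ x.2).trans_eq
    (Finset.sum_congr rfl fun i _ => ?_)
  have : (fun x : {x : Fin n × ι // x.2 = i} => ρ x.1.2) = fun _ => ρ i :=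
    funext fun x => by rw [x.2]
  rw [this]
  refine entReal_tensorFamily_const (hρ i) ?_
  rw [Fintype.card_congr (β := Fin n)
    { toFun := fun x => x.1.1
      invFun := fun k => ⟨(k, i), rfl⟩
      left_inv := by rintro ⟨⟨x, y⟩, rfl⟩; rfl
      right_inv := fun _ => rfl }, Fintype.card_fin]

/-- Choosing m occurrences of every letter extracts m copies of the full tensor product; each of the
remaining positions costs at most C. -/
theorem entReal_tensorFamily_word_le {ρ : ι → Matrix (a × b) (a × b) ℂ}
    (hρ : ∀ i, IsDensity (ρ i)) {C : ℝ} (hC : ∀ i, entReal (ρ i) ≤ C) {n m : ℕ} (w : Fin n → ι)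
    (hm : ∀ i, m ≤ Fintype.card {k // w k = i}) :
    entReal (tensorFamily fun k => ρ (w k)) ≤
      entReal (tensorPower (tensorFamily ρ) m) + ((n : ℝ) - Fintype.card ι * m) * C := by
  classical
  have hemb : ∀ i, Nonempty (Fin m ↪ {k // w k = i}) := fun i =>
    Function.Embedding.nonempty_of_card_le (by simpa using hm i)
  -- φ (j, i) is the position of the j-th chosen occurrence of the letter i.
  let φ : Fin m × ι → Fin n := fun x => (hemb x.2).some x.1
  have hwφ : ∀ x, w (φ x) = x.2 := fun x => ((hemb x.2).some x.1).2
  have hφ : Function.Injective φ := by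
    rintro ⟨j, i⟩ ⟨j', i'⟩ h
    have hi : i = i' := by
      have := congrArg w h
      rwa [hwφ, hwφ] at this
    subst hi
    exact congrArg (·, i) ((hemb i).some.injective (Subtype.ext h))
  let g : Fin n → Bool := fun k => decide (k ∈ Set.range φ)
  let e : Fin m × ι ≃ {k // g k = true} :=
    (Equiv.ofInjective φ hφ).trans (Equiv.subtypeEquivRight fun k => by simp [g])
  refine (entReal_tensorFamily_le_sum_fiber g fun k => hρ (w k)).trans ?_
  rw [Fintype.sum_bool]
  refine add_le_add (le_of_eq ?_) ?_
  · rw [entReal_tensorPower_tensorFamily hρ,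
      ← entReal_tensorFamily_comp (fun k : {k // g k = true} => hρ (w k)) e]
    congr 2
    funext x
    exact congrArg ρ (hwφ x)
  · refine (entReal_tensorFamily_le fun k => hρ _).trans ?_
    refine (Finset.sum_le_sum fun k _ => hC _).trans_eq ?_
    rw [Finset.sum_const, nsmul_eq_mul, Finset.card_univ]
    congr 1
    have h1 := Fintype.sum_fiberwise g fun _ => (1 : ℝ)
    have h2 : Fintype.card {k // g k = true} = m * Fintype.card ι := by
      rw [← Fintype.card_congr e]; simp
    simp only [Finset.sum_const, nsmul_eq_mul, mul_one, Finset.card_univ, Fintype.sum_bool,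
      h2, Fintype.card_fin] at h1
    push_cast at h1
    linarith

end Regrouping

/-! ### Second moments of letter counts -/

section Counting

variable {d : ℕ}

theorem sum_sq_indicator_sub_le (hd : 1 ≤ d) (x : Fin d) :
    ∑ i : Fin d, ((if x = i then 1 else 0) - 1 / (d : ℝ)) ^ 2 ≤ 1 := by
  have hd' : (0 : ℝ) < d := by positivity
  have : ∀ i : Fin d, ((if x = i then 1 else 0) - 1 / (d : ℝ)) ^ 2 =
      (if x = i then 1 else 0) * (1 - 2 / d) + 1 / (d : ℝ) ^ 2 := fun i => by
    split_ifs <;> ring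
  simp only [this]
  rw [Finset.sum_add_distrib, ← Finset.sum_mul, Finset.sum_ite_eq]
  simp only [Finset.mem_univ, if_true, Finset.sum_const, Finset.card_univ, Fintype.card_fin,
    nsmul_eq_mul]
  have h1 : (d : ℝ) * (1 / (d : ℝ) ^ 2) = 1 / d := by field_simp
  have h2 : 0 < 1 / (d : ℝ) := by positivity
  have h3 : 2 / (d : ℝ) = 2 * (1 / d) := by ring
  rw [h1, h3]
  linarith

/-- This is a variance bound for uniformly random words, multiplied by d^n: the centred indicators
have mean zero, so cross terms vanish and each letter adds at most 1 to the mean. -/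
theorem sum_sq_deviation_le (hd : 1 ≤ d) (n : ℕ) :
    ∑ w : Fin n → Fin d, ∑ i : Fin d,
      (∑ k, ((if w k = i then 1 else 0) - 1 / (d : ℝ))) ^ 2 ≤ n * (d : ℝ) ^ n := by
  have hd' : (0 : ℝ) < d := by positivity
  induction n with
  | zero => simp
  | succ n ih =>
    set y : Fin d → Fin d → ℝ := fun i x => (if x = i then 1 else 0) - 1 / (d : ℝ) with hy
    have hy0 : ∀ i, ∑ x, y i x = 0 := fun i => by
      simp only [hy, Finset.sum_sub_distrib, Finset.sum_ite_eq', Finset.mem_univ, if_true,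
        Finset.sum_const, Finset.card_univ, Fintype.card_fin, nsmul_eq_mul]
      field_simp
      ring
    have hy2 : ∑ x, ∑ i, y i x ^ 2 ≤ d :=
      (Finset.sum_le_sum fun x _ => sum_sq_indicator_sub_le hd x).trans_eq (by simp)
    calc ∑ w : Fin (n + 1) → Fin d, ∑ i, (∑ k, y i (w k)) ^ 2
        = ∑ w : Fin n → Fin d, ∑ x, ∑ i, (y i x + ∑ k, y i (w k)) ^ 2 := by
          rw [← (Fin.consEquiv fun _ => Fin d).sum_comp, Fintype.sum_prod_type, Finset.sum_comm]
          simp [Fin.consEquiv, Fin.sum_univ_succ]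
      _ = ∑ w : Fin n → Fin d, (∑ x, ∑ i, y i x ^ 2 + d * ∑ i, (∑ k, y i (w k)) ^ 2) := by
          refine Finset.sum_congr rfl fun w _ => ?_
          rw [Finset.sum_comm, Finset.sum_comm (f := fun x i => y i x ^ 2), Finset.mul_sum,
            ← Finset.sum_add_distrib]
          refine Finset.sum_congr rfl fun i _ => ?_
          simp only [add_sq]
          rw [Finset.sum_add_distrib, Finset.sum_add_distrib, ← Finset.sum_mul,
            ← Finset.mul_sum, hy0]
          simp
      _ ≤ ∑ w : Fin n → Fin d, ((d : ℝ) + d * ∑ i, (∑ k, y i (w k)) ^ 2) := by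
          gcongr
      _ = (d : ℝ) ^ (n + 1) +
          d * ∑ w : Fin n → Fin d, ∑ i, (∑ k, y i (w k)) ^ 2 := by
          rw [Finset.sum_add_distrib, ← Finset.mul_sum]
          simp [pow_succ]
      _ ≤ (d : ℝ) ^ (n + 1) + d * (n * (d : ℝ) ^ n) := by gcongr
      _ = _ := by push_cast; ring

/-- Here m is the least letter count, and n - dm is -d times the deviation x of that letter.
Bounding -dx by a small linear term plus a multiple of x² takes the place of Chebyshev's inequality:
it holds for every word and can simply be averaged. -/
theorem exists_count_lower_bound (hd : 1 ≤ d) {n : ℕ} (hn : 1 ≤ n) (w : Fin n → Fin d) {δ : ℝ}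
    (hδ : 0 < δ) : ∃ m : ℕ, (∀ i, m ≤ Fintype.card {k // w k = i}) ∧ 0 ≤ (n : ℝ) - d * m ∧
      (n : ℝ) - d * m ≤ δ * n + d ^ 2 / (4 * δ * n) *
        ∑ i : Fin d, (∑ k, ((if w k = i then 1 else 0) - 1 / (d : ℝ))) ^ 2 := by
  have hne : Nonempty (Fin d) := ⟨⟨0, hd⟩⟩
  have hd' : (0 : ℝ) < d := by positivity
  have hn' : (0 : ℝ) < n := by positivity
  obtain ⟨i, hi⟩ := Finite.exists_min fun i => Fintype.card {k // w k = i}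
  refine ⟨Fintype.card {k // w k = i}, hi, ?_, ?_⟩
  · have h1 := Fintype.sum_fiberwise w fun _ => (1 : ℕ)
    simp only [Finset.sum_const, smul_eq_mul, mul_one, Finset.card_univ, Fintype.card_fin] at h1
    have h2 := Finset.sum_le_sum fun j (_ : j ∈ Finset.univ) => hi j
    rw [h1] at h2
    simp only [Finset.sum_const, smul_eq_mul, Finset.card_univ, Fintype.card_fin] at h2
    have : ((d * Fintype.card {k // w k = i} : ℕ) : ℝ) ≤ n := by exact_mod_cast h2
    push_cast at this
    linarith
  · set x : ℝ := ∑ k, ((if w k = i then 1 else 0) - 1 / (d : ℝ)) with hx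
    have hxe : (n : ℝ) - d * Fintype.card {k // w k = i} = - (d * x) := by
      rw [hx, Finset.sum_sub_distrib, Finset.sum_boole, Fintype.card_subtype]
      simp only [Finset.sum_const, Finset.card_univ, Fintype.card_fin, nsmul_eq_mul]
      field_simp
      ring
    have hle : x ^ 2 ≤ ∑ i : Fin d, (∑ k, ((if w k = i then 1 else 0) - 1 / (d : ℝ))) ^ 2 :=
      Finset.single_le_sum (f := fun i : Fin d =>
        (∑ k, ((if w k = i then 1 else 0) - 1 / (d : ℝ))) ^ 2) (fun j _ => sq_nonneg _)
        (Finset.mem_univ i)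
    rw [hxe]
    calc -(d * x) ≤ δ * n + d ^ 2 / (4 * δ * n) * x ^ 2 := by
          -- Completing the square.
          have : δ * n + d ^ 2 / (4 * δ * n) * x ^ 2 + d * x =
              (2 * δ * n + d * x) ^ 2 / (4 * δ * n) := by
            field_simp
            ring
          have h2 : 0 ≤ (2 * δ * n + d * x) ^ 2 / (4 * δ * n) := by positivity
          linarith
      _ ≤ _ := by gcongr

end Counting

/-! ### Existence of the limits and comparison of rates -/

section Rates

variable {a b : Type*} [Fintype a] [Fintype b] [DecidableEq a] [DecidableEq b]

theorem exists_tendsto_entReal_rate {ρ : Matrix (a × b) (a × b) ℂ} (hρ : IsDensity ρ) :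
    ∃ L : ℝ, Tendsto (fun n : ℕ => entReal (tensorPower ρ n) / n) atTop (𝓝 L) := by
  -- Fekete's lemma; the minimum with 0 accounts for n = 0, where the quotient is 0 by convention.
  refine ⟨_, (subadditive_entReal_tensorPower hρ).tendsto_lim
    ⟨min 0 (traceLog ρ ρ).re, ?_⟩⟩
  rintro _ ⟨n, rfl⟩
  rcases Nat.eq_zero_or_pos n with rfl | hn
  · simp
  · refine (min_le_right _ _).trans ?_
    have hn' : (0 : ℝ) < n := by positivity
    have h : _ ≤ entReal (tensorPower ρ n) :=
      traceLog_le_entReal (IsDensity.tensorFamily fun _ : Fin n => hρ)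
    rw [tensorPower, traceLog_tensorFamily fun _ : Fin n => hρ] at h
    simp only [le_div_iff₀ hn']
    rw [mul_comm]
    simpa [tensorPower] using h

theorem relEntEntRate_eq {ρ : Matrix (a × b) (a × b) ℂ} (hρ : IsDensity ρ) (n : ℕ) :
    relEntEntRate ρ n = ((entReal (tensorPower ρ n) / n : ℝ) : EReal) := by
  rw [relEntEntRate, ← coe_entReal (ρ := tensorPower ρ n) (IsDensity.tensorFamily fun _ => hρ),
    ← EReal.coe_mul]
  congr 1
  ring

theorem exists_regRelEntEnt_eq {ρ : Matrix (a × b) (a × b) ℂ} (hρ : IsDensity ρ) :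
    ∃ L : ℝ, regRelEntEnt ρ = (L : EReal) ∧
      Tendsto (fun n : ℕ => entReal (tensorPower ρ n) / n) atTop (𝓝 L) ∧
      Tendsto (relEntEntRate ρ) atTop (𝓝 (regRelEntEnt ρ)) := by
  obtain ⟨L, hL⟩ := exists_tendsto_entReal_rate hρ
  have h : Tendsto (relEntEntRate ρ) atTop (𝓝 (L : EReal)) := by
    rw [show relEntEntRate ρ = _ from funext (relEntEntRate_eq hρ)]
    exact (continuous_coe_real_ereal.tendsto L).comp hL
  have hreg : regRelEntEnt ρ = (L : EReal) := h.limUnder_eq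
  exact ⟨L, hreg, hL, hreg ▸ h⟩

end Rates

/-- The least letter count m may be small even in a long word, so a bound valid for all indices is
needed; C absorbs the finitely many early terms. -/
theorem exists_linear_bound {s : ℕ → ℝ} {L M : ℝ}
    (hs : Tendsto (fun n : ℕ => s n / n) atTop (𝓝 L)) (hM : L < M) :
    ∃ C, ∀ n, s n ≤ n * M + C := by
  obtain ⟨N, hN⟩ := eventually_atTop.1 (hs.eventually_lt_const hM)
  refine ⟨∑ n ∈ Finset.range (N + 1), |s n - n * M|, fun n => ?_⟩
  have hnn : 0 ≤ ∑ n ∈ Finset.range (N + 1), |s n - n * M| :=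
    Finset.sum_nonneg fun _ _ => abs_nonneg _
  rcases Nat.lt_or_ge n (N + 1) with h | h
  · have := Finset.single_le_sum (f := fun n => |s n - n * M|) (fun _ _ => abs_nonneg _)
      (Finset.mem_range.2 h)
    linarith [le_abs_self (s n - n * M)]
  · have hn : (0 : ℝ) < n := by
      have : 0 < n := by omega
      exact_mod_cast this
    have := hN n (by omega)
    rw [div_lt_iff₀ hn] at this
    linarith

theorem rate_privateState_le {d : ℕ} {a b : Type*} [Fintype a] [Fintype b] [DecidableEq a]
    [DecidableEq b] (hd : 1 ≤ d) (e f : OrthonormalBasis (Fin d) ℂ (EuclideanSpace ℂ (Fin d)))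
    (U : Fin d → Matrix.unitaryGroup (a × b) ℂ) {σ : Matrix (a × b) (a × b) ℂ}
    (hσ : IsDensity σ) {G S : ℝ}
    (hG : Tendsto (fun n : ℕ => entReal (tensorPower (privateState e f U σ) n) / n) atTop (𝓝 G))
    (hS : Tendsto (fun n : ℕ => entReal (tensorPower (tensorFamily (conditionalState U σ)) n) / n)
      atTop (𝓝 S)) : G ≤ Real.log d + 1 / d * S := by
  have hd' : (0 : ℝ) < d := by positivity
  have hρ := IsDensity.conditionalState U hσ
  obtain ⟨C, hC⟩ : ∃ C, ∀ i, entReal (conditionalState U σ i) ≤ C :=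
    ⟨_, fun i => (Finset.single_le_sum (f := fun i => |entReal (conditionalState U σ i)|)
      (fun _ _ => abs_nonneg _) (Finset.mem_univ i)).trans' (le_abs_self _)⟩
  suffices hM : ∀ M, S < M → G ≤ Real.log d + 1 / d * M by
    refine le_of_forall_pos_le_add fun ε hε => (hM (S + d * ε) (by nlinarith)).trans_eq ?_
    field_simp
    ring
  intro M hSM
  obtain ⟨K, hK⟩ := exists_linear_bound hS hSM
  -- A leftover position costs at most C instead of the M/d budgeted per position; the absolute
  -- value is needed because the difference can have either sign.
  set C' := |C - M / d| with hC'
  have hC'0 : 0 ≤ C' := abs_nonneg _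
  suffices hδ : ∀ δ, 0 < δ → G ≤ Real.log d + 1 / d * M + C' * δ by
    refine le_of_forall_pos_le_add fun ε hε => (hδ (ε / (C' + 1)) (by positivity)).trans ?_
    gcongr
    rw [mul_div_assoc', div_le_iff₀ (by positivity)]
    nlinarith
  intro δ hδ
  have hword : ∀ n : ℕ, 1 ≤ n → ∀ w : Fin n → Fin d,
      entReal (tensorFamily fun k => conditionalState U σ (w k)) ≤
        n * (1 / d * M) + K + C' * (δ * n) + C' * (d ^ 2 / (4 * δ * n)) *
        ∑ i : Fin d, (∑ k, ((if w k = i then 1 else 0) - 1 / (d : ℝ))) ^ 2 := by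
    intro n hn w
    obtain ⟨m, hm, hm0, hmle⟩ := exists_count_lower_bound hd hn w hδ
    have h1 := entReal_tensorFamily_word_le hρ hC w hm
    rw [Fintype.card_fin] at h1
    have h2 := hK m
    have h3 : (m : ℝ) * M = n * (1 / d * M) - (n - d * m) * (M / d) := by
      field_simp
      ring
    have h4 : ((n : ℝ) - d * m) * (C - M / d) ≤ (n - d * m) * C' :=
      mul_le_mul_of_nonneg_left (le_abs_self _) hm0
    have h5 := mul_le_mul_of_nonneg_right hmle hC'0
    nlinarith
  -- On averaging over words, the 1/n in front of the squared deviations cancels the factor n in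
  -- their mean, which leaves an error constant in n before division.
  have hbound : ∀ n : ℕ, 1 ≤ n → entReal (tensorPower (privateState e f U σ) n) / n ≤
      Real.log d + 1 / d * M + C' * δ + (K + C' * (d ^ 2 / (4 * δ))) / n := by
    intro n hn
    have hn' : (0 : ℝ) < n := by positivity
    have h1 := entReal_tensorPower_privateState_le e f U hd hσ n
    have h2 := Finset.sum_le_sum fun w (_ : w ∈ Finset.univ) => hword n hn w
    rw [Finset.sum_add_distrib, ← Finset.mul_sum] at h2
    have h3 := mul_le_mul_of_nonneg_left (sum_sq_deviation_le hd n)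
      (show 0 ≤ C' * (d ^ 2 / (4 * δ * n)) by positivity)
    simp only [Finset.sum_const, Finset.card_univ, Fintype.card_pi, Fintype.card_fin,
      Finset.prod_const, nsmul_eq_mul, Nat.cast_pow] at h2
    have h4 := mul_le_mul_of_nonneg_left (h2.trans (add_le_add_right h3 _))
      (show 0 ≤ ((d : ℝ) ^ n)⁻¹ by positivity)
    have hp : (d : ℝ) ^ n ≠ 0 := by positivity
    rw [div_le_iff₀ hn']
    refine h1.trans ((add_le_add_right h4 _).trans_eq ?_)
    field_simp
    ring
  have hlim : Tendsto (fun n : ℕ => Real.log d + 1 / d * M + C' * δ +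
      (K + C' * (d ^ 2 / (4 * δ))) / n) atTop (𝓝 (Real.log d + 1 / d * M + C' * δ + 0)) :=
    tendsto_const_nhds.add (tendsto_const_div_atTop_nhds_zero_nat _)
  rw [add_zero] at hlim
  exact le_of_tendsto_of_tendsto hG hlim (eventually_atTop.2 ⟨1, hbound⟩)

theorem rate_tensorFamily_le {ι : Type*} [Fintype ι] [DecidableEq ι] {a b : Type*} [Fintype a]
    [Fintype b] [DecidableEq a] [DecidableEq b] {ρ : ι → Matrix (a × b) (a × b) ℂ}
    (hρ : ∀ i, IsDensity (ρ i)) {S : ℝ} {s : ι → ℝ}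
    (hS : Tendsto (fun n : ℕ => entReal (tensorPower (tensorFamily ρ) n) / n) atTop (𝓝 S))
    (hs : ∀ i, Tendsto (fun n : ℕ => entReal (tensorPower (ρ i) n) / n) atTop (𝓝 (s i))) :
    S ≤ ∑ i, s i := by
  refine le_of_tendsto_of_tendsto' hS (tendsto_finsetSum _ fun i _ => hs i) fun n => ?_
  rw [← Finset.sum_div]
  gcongr
  exact entReal_tensorPower_tensorFamily_le hρ n

theorem ereal_coe_sum {ι : Type*} (t : Finset ι) (x : ι → ℝ) :
    ((∑ i ∈ t, x i : ℝ) : EReal) = ∑ i ∈ t, (x i : EReal) := by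
  classical
  induction t using Finset.induction_on with
  | empty => simp
  | insert i t hi ih => rw [Finset.sum_insert hi, Finset.sum_insert hi, EReal.coe_add, ih]

end QInfo

theorem theorem2 (d dA dB : ℕ) (hd : 1 ≤ d)
    (e f : OrthonormalBasis (Fin d) ℂ (EuclideanSpace ℂ (Fin d)))
    (U : Fin d → Matrix.unitaryGroup (Fin dA × Fin dB) ℂ)
    (σ : Matrix (Fin dA × Fin dB) (Fin dA × Fin dB) ℂ) (hσ : QInfo.IsDensity σ) :
    -- the limits that define the regularized quantities exist
    Tendsto (QInfo.relEntEntRate (QInfo.privateState e f U σ)) atTop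
        (𝓝 (QInfo.regRelEntEnt (QInfo.privateState e f U σ))) ∧
      Tendsto (QInfo.relEntEntRate (QInfo.tensorFamily (QInfo.conditionalState U σ))) atTop
        (𝓝 (QInfo.regRelEntEnt (QInfo.tensorFamily (QInfo.conditionalState U σ)))) ∧
      (∀ i, Tendsto (QInfo.relEntEntRate (QInfo.conditionalState U σ i)) atTop
        (𝓝 (QInfo.regRelEntEnt (QInfo.conditionalState U σ i)))) ∧
      -- the upper bound
      QInfo.regRelEntEnt (QInfo.privateState e f U σ) ≤
        (Real.log d : EReal) + ((1 / (d : ℝ) : ℝ) : EReal) *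
          QInfo.regRelEntEnt (QInfo.tensorFamily (QInfo.conditionalState U σ)) ∧
      -- it is at least as tight as the bound by the sum over the conditional states
      (Real.log d : EReal) + ((1 / (d : ℝ) : ℝ) : EReal) *
          QInfo.regRelEntEnt (QInfo.tensorFamily (QInfo.conditionalState U σ)) ≤
        (Real.log d : EReal) + ((1 / (d : ℝ) : ℝ) : EReal) *
          ∑ i, QInfo.regRelEntEnt (QInfo.conditionalState U σ i) := by
  have hσ' := QInfo.IsDensity.conditionalState U hσ
  -- All regularized quantities are finite, so the extended-real inequalities reduce to real ones.
  obtain ⟨G, hG, hGlim, hGrate⟩ :=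
    QInfo.exists_regRelEntEnt_eq (QInfo.IsDensity.privateState e f U hd hσ)
  obtain ⟨S, hS, hSlim, hSrate⟩ :=
    QInfo.exists_regRelEntEnt_eq (QInfo.IsDensity.tensorFamily hσ')
  choose s hs hslim hsrate using fun i => QInfo.exists_regRelEntEnt_eq (hσ' i)
  refine ⟨hGrate, hSrate, hsrate, ?_, ?_⟩
  · rw [hG, hS, ← EReal.coe_mul, ← EReal.coe_add, EReal.coe_le_coe_iff]
    exact QInfo.rate_privateState_le hd e f U hσ hGlim hSlim
  · simp only [hs]
    rw [hS, ← QInfo.ereal_coe_sum, ← EReal.coe_mul, ← EReal.coe_mul, ← EReal.coe_add,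
      ← EReal.coe_add, EReal.coe_le_coe_iff]
    gcongr
    exact QInfo.rate_tensorFamily_le hσ' hSlim hslim
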